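/- For each $n\ge 1$, let $(\Omega_n,\mathcal A_n,\mathbb P_n,(\theta_x)_{x\in\mathbb R^n})$ be a stationary framework, i.e. a probability space with a measurable flow $(\theta_x)$ that preserves $\mathbb P_n$. On it let $N_n$ be a Poisson point process in $\mathbb R^n$ with intensity $\lambda_n = n^{n(\alpha-1)}e^{n\lambda}$, where $\lambda,\alpha\in\mathbb R$, and let $X_n$ be a stationary and isotropic Poisson hyperplane process in $\mathbb R^n$ with intensity $\gamma_n>0$, i.e. a Poisson process on the space of hyperplanes $H(u,\tau)=\{x:\langle x,u\rangle=\tau\}$ with intensity measure \[ \Theta_n(A) = 2\gamma_n\int_{S^{n-1}}\int_0^\infty \mathbf 1\{H(u,\tau)\in A\}\,d\tau\,\sigma_n(du), \] $\sigma_n$ being the uniform probability measure on the unit sphere. Assume that $N_n$ and $X_n$ are independent and compatible with the flow: $N_n\circ\theta_x = N_n - x$ and $X_n\circ\theta_x = X_n - x$ (translation by $-x$). Let $Z_{0,n}$ be the zero cell, that is, the closed cell containing the origin of the tessellation of $\mathbb R^n$ induced by $X_n$. Let \[ \mathbb P_n^0(A) = \frac1{\lambda_n}\,\mathbb E_n\Big[\int_{B}\mathbf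 1_A\circ\theta_x\,N_n(dx)\Big] \] be the Palm probability of $N_n$, where $B\subset\mathbb R^n$ is any bounded Borel set of volume one, and let $\mathbb E_n^{0,!}[N_n(Z_{0,n})] = \mathbb E_n^0[(N_n-\delta_0)(Z_{0,n})]$ be the reduced Palm expectation (the point at the origin is removed from $N_n$). Suppose that $\gamma_n\sim\rho n^\alpha$ as $n\to\infty$ for some $\rho>0$. Then \[ \lim_{n\to\infty}\mathbb E_n^{0,!}[N_n(Z_{0,n})] = \begin{cases} 0, & \rho > e^\lambda\pi/\sqrt e,\\ \infty, & \rho < e^\lambda\pi/\sqrt e,\end{cases} \] and, for $\rho > e^\lambda\pi/\sqrt e$, \[ \lim_{n\to\infty}\mathbb P_n^0\big(N_n(Z_{0,n}) = 1\big) = 1. \] -/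

import Mathlib

open MeasureTheory ProbabilityTheory Filter Topology Asymptotics

noncomputable section

/-- Euclidean space `ℝⁿ`. -/
abbrev Eucl (n : ℕ) : Type := EuclideanSpace ℝ (Fin n)

/-! ### The space of hyperplanes -/

/-- Affine hyperplanes `H(u, τ) = {x | ⟪x, u⟫ = τ}`, `‖u‖ = 1`, `τ ∈ ℝ`, of `ℝⁿ`. -/
@[ext]
structure Hyperplane (n : ℕ) where
  carrier : Set (Eucl n)
  exists_normal : ∃ u ∈ Metric.sphere (0 : Eucl n) 1, ∃ τ : ℝ, carrier = {x | inner ℝ x u = τ}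

namespace Hyperplane

variable {n : ℕ}

/-- The hyperplanes that hit the set `C`. -/
def hitting (C : Set (Eucl n)) : Set (Hyperplane n) := {h | (h.carrier ∩ C).Nonempty}

/-- The `σ`-algebra on hyperplanes, generated by the sets of hyperplanes hitting a compact set
(the trace of the Borel `σ`-algebra of the Fell topology on closed sets). -/
instance : MeasurableSpace (Hyperplane n) :=
  MeasurableSpace.generateFrom {A | ∃ C : Set (Eucl n), IsCompact C ∧ A = hitting C}

theorem measurableSet_hitting {C : Set (Eucl n)} (hC : IsCompact C) :
    MeasurableSet (hitting C) :=
  MeasurableSpace.measurableSet_generateFrom ⟨C, hC, rfl⟩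

/-- The hyperplane `H(u, τ)`. -/
def ofNormal (p : Metric.sphere (0 : Eucl n) 1 × ℝ) : Hyperplane n where
  carrier := {x | inner ℝ x (p.1 : Eucl n) = p.2}
  exists_normal := ⟨p.1, p.1.2, p.2, rfl⟩

theorem measurable_ofNormal : Measurable (ofNormal (n := n)) := by
  refine measurable_generateFrom ?_
  rintro _ ⟨C, hC, rfl⟩
  have hcl : IsClosed (Prod.snd '' {q : C × (Metric.sphere (0 : Eucl n) 1 × ℝ) |
      inner ℝ (q.1 : Eucl n) (q.2.1 : Eucl n) = q.2.2}) := by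
    have : CompactSpace C := isCompact_iff_compactSpace.1 hC
    refine isClosedMap_snd_of_compactSpace _ (isClosed_eq ?_ ?_) <;> fun_prop
  convert hcl.measurableSet using 1
  ext p
  constructor
  · rintro ⟨x, hx, hxC⟩
    exact ⟨(⟨x, hxC⟩, p), hx, rfl⟩
  · rintro ⟨⟨x, q⟩, hx, rfl⟩
    exact ⟨x, hx, x.2⟩

/-- The translate `h + v` of a hyperplane. -/
def translate (v : Eucl n) (h : Hyperplane n) : Hyperplane n where
  carrier := (fun x => x + v) '' h.carrier
  exists_normal := by
    obtain ⟨u, hu, τ, h⟩ := h.exists_normal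
    refine ⟨u, hu, τ + inner ℝ v u, ?_⟩
    rw [h]
    ext x
    simp only [Set.mem_image, Set.mem_ofPred_eq]
    constructor
    · rintro ⟨y, hy, rfl⟩
      rw [inner_add_left, hy]
    · intro hx
      exact ⟨x - v, by rw [inner_sub_left, hx]; ring, by simp⟩

theorem measurable_translate (v : Eucl n) : Measurable (translate v) := by
  refine measurable_generateFrom ?_
  rintro _ ⟨C, hC, rfl⟩
  have hC' : IsCompact ((fun x => x - v) '' C) := hC.image (by fun_prop)
  convert measurableSet_hitting hC' using 1
  ext h
  constructor
  · rintro ⟨_, ⟨x, hx, rfl⟩, hxC⟩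
    exact ⟨x, hx, x + v, hxC, by simp⟩
  · rintro ⟨_, hx, x, hxC, rfl⟩
    exact ⟨x, ⟨x - v, hx, by simp⟩, hxC⟩

theorem eq_of_subset {g h : Hyperplane n} (hs : g.carrier ⊆ h.carrier) : g = h := by
  obtain ⟨u, hu, τ, hg⟩ := g.exists_normal
  obtain ⟨v, hv, s, hh⟩ := h.exists_normal
  have hu1 : inner ℝ u u = 1 := by
    rw [real_inner_self_eq_norm_sq, mem_sphere_zero_iff_norm.1 hu, one_pow]
  have hv1 : inner ℝ v v = 1 := by
    rw [real_inner_self_eq_norm_sq, mem_sphere_zero_iff_norm.1 hv, one_pow]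
  have huv : inner ℝ v u = inner ℝ u v := real_inner_comm _ _
  have key : ∀ w : Eucl n, inner ℝ w u = 0 → τ * inner ℝ u v + inner ℝ w v = s := by
    intro w hw
    have h1 : τ • u + w ∈ g.carrier := by
      rw [hg, Set.mem_ofPred_eq, inner_add_left, inner_smul_left, hw, hu1]
      simp
    have h2 := hs h1
    rw [hh, Set.mem_ofPred_eq, inner_add_left, inner_smul_left] at h2
    simpa using h2
  have h0 := key 0 (by simp)
  rw [inner_zero_left, add_zero] at h0
  set c := inner ℝ u v with hc
  have hw0 : inner ℝ (v - c • u) u = 0 := by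
    rw [inner_sub_left, inner_smul_left, hu1, huv]
    simp
  have hwv : inner ℝ (v - c • u) v = 0 := by
    have := key _ hw0
    linarith
  have hvc : v = c • u := by
    rw [← sub_eq_zero, ← inner_self_eq_zero (𝕜 := ℝ)]
    rw [inner_sub_right, inner_smul_right, hwv, hw0]
    simp
  have hcc : c * c = 1 := by
    rw [inner_sub_left, inner_smul_left, hv1, ← hc] at hwv
    simp at hwv
    linarith
  have hc0 : c ≠ 0 := by
    rintro h
    simp [h] at hcc
  ext x
  rw [hg, hh, Set.mem_ofPred_eq, Set.mem_ofPred_eq, hvc, inner_smul_right, ← h0, mul_comm τ c]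
  exact (mul_right_inj' hc0).symm

instance : MeasurableSingletonClass (Hyperplane n) := by
  refine ⟨fun h => ?_⟩
  obtain ⟨D, hDc, hDd⟩ := TopologicalSpace.exists_countable_dense (Eucl n)
  have hcl : IsClosed h.carrier := by
    obtain ⟨u, -, τ, hh⟩ := h.exists_normal
    rw [hh]
    exact isClosed_eq (by fun_prop) (by fun_prop)
  have e : {h} = ⋂ q ∈ D, ⋂ k : ℕ, ⋂ _ : Disjoint h.carrier (Metric.closedBall q (1 / (k + 1))),
      (hitting (Metric.closedBall q (1 / ((k : ℝ) + 1))))ᶜ := by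
    ext g
    simp only [Set.mem_iInter, Set.mem_singleton_iff]
    constructor
    · rintro rfl q - k hd
      exact fun hn => Set.not_disjoint_iff_nonempty_inter.2 hn hd
    · intro H
      refine eq_of_subset fun x hx => ?_
      by_contra hxh
      obtain ⟨ε, hε, hb⟩ := Metric.isOpen_iff.1 hcl.isOpen_compl x hxh
      obtain ⟨k, hk⟩ := exists_nat_one_div_lt (half_pos hε)
      have hkp : (0 : ℝ) < 1 / ((k : ℝ) + 1) := by positivity
      obtain ⟨q, hq, hxq⟩ := hDd.exists_dist_lt x hkp
      refine H q hq k ?_ ⟨x, hx, Metric.mem_closedBall.2 hxq.le⟩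
      rw [Set.disjoint_left]
      intro y hy hyq
      refine hb (Metric.mem_ball.2 ?_) hy
      have h1 := dist_triangle y q x
      rw [dist_comm q x] at h1
      have h2 := Metric.mem_closedBall.1 hyq
      linarith
  rw [e]
  refine MeasurableSet.biInter hDc fun q _ => MeasurableSet.iInter fun k =>
    MeasurableSet.iInter fun _ => (measurableSet_hitting (isCompact_closedBall _ _)).compl

end Hyperplane

/-! ### Counting measures and Poisson processes -/

/-- A counting measure: a countable sum of Dirac masses (repetitions are allowed). -/
def IsCountingMeasure {S : Type*} [MeasurableSpace S] (μ : Measure S) : Prop :=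
  ∃ (ι : Type) (_ : Countable ι) (p : ι → S), μ = Measure.sum fun i => Measure.dirac (p i)

/-- The random measure `ξ` is Poisson with intensity measure `Θ`: for disjoint measurable
`A₁, …, A_k` of finite intensity, the masses `ξ(A_i)` are independent Poisson variables with means
`Θ(A_i)`. -/
structure IsPoissonProcess {Ω S : Type*} [MeasurableSpace Ω] [MeasurableSpace S]
    (P : Measure Ω) (ξ : Ω → Measure S) (Θ : Measure S) : Prop where
  measurable : Measurable ξ
  counting : ∀ ω, IsCountingMeasure (ξ ω)
  prob_eq : ∀ (k : ℕ) (A : Fin k → Set S) (m : Fin k → ℕ),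
    (∀ i, MeasurableSet (A i)) → Pairwise (Function.onFun Disjoint A) → (∀ i, Θ (A i) < ⊤) →
      P {ω | ∀ i, ξ ω (A i) = m i} = ∏ i, poissonMeasure (Θ (A i)).toNNReal {m i}

/-- The normalized spherical Lebesgue measure on the unit sphere of `ℝⁿ`. -/
def sphereUniform (n : ℕ) : Measure (Metric.sphere (0 : Eucl n) 1) :=
  ((volume : Measure (Eucl n)).toSphere Set.univ)⁻¹ • (volume : Measure (Eucl n)).toSphere

/-- The intensity measure of the stationary and isotropic hyperplane process of intensity `γ`:
`Θ(A) = 2γ ∫_{S^{n-1}} ∫_0^∞ 1{H(u, τ) ∈ A} dτ σ(du)`. -/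
def hyperplaneIntensity (n : ℕ) (γ : ℝ) : Measure (Hyperplane n) :=
  ENNReal.ofReal (2 * γ) •
    ((sphereUniform n).prod (volume.restrict (Set.Ioi (0 : ℝ)))).map Hyperplane.ofNormal

/-- A Poisson point process in `ℝⁿ` of intensity `lam` (automatically stationary). -/
structure IsPoissonPointProcess {n : ℕ} {Ω : Type*} [MeasurableSpace Ω] (P : Measure Ω)
    (N : Ω → Measure (Eucl n)) (lam : ℝ) : Prop where
  poisson : IsPoissonProcess P N (ENNReal.ofReal lam • (volume : Measure (Eucl n)))
  locallyFinite : ∀ ω, ∀ C : Set (Eucl n), IsCompact C → N ω C < ⊤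

/-- A stationary and isotropic Poisson hyperplane process in `ℝⁿ` of intensity `γ`. -/
structure IsPoissonHyperplaneProcess {n : ℕ} {Ω : Type*} [MeasurableSpace Ω] (P : Measure Ω)
    (X : Ω → Measure (Hyperplane n)) (γ : ℝ) : Prop where
  poisson : IsPoissonProcess P X (hyperplaneIntensity n γ)
  locallyFinite : ∀ ω, ∀ C : Set (Eucl n), IsCompact C → X ω (Hyperplane.hitting C) < ⊤

/-- The zero cell of the tessellation induced by the hyperplanes charged by `χ`: the closure of the
connected component of the origin in the complement of the union of the hyperplanes. (It is empty
if the origin lies on one of the hyperplanes.) -/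
def zeroCell {n : ℕ} (χ : Measure (Hyperplane n)) : Set (Eucl n) :=
  closure (connectedComponentIn (⋃ h ∈ {h : Hyperplane n | χ {h} ≠ 0}, h.carrier)ᶜ 0)

/-! ### Stationary frameworks and Palm probabilities -/

/-- `(Ω, P, θ)` is a stationary framework: `θ` is a measurable flow indexed by `ℝⁿ` that
preserves `P`. -/
structure IsStationaryFramework {n : ℕ} {Ω : Type*} [MeasurableSpace Ω] (P : Measure Ω)
    (θ : Eucl n → Ω → Ω) : Prop where
  measurable : Measurable fun q : Eucl n × Ω => θ q.1 q.2
  zero : ∀ ω, θ 0 ω = ω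
  add : ∀ x y ω, θ (x + y) ω = θ x (θ y ω)
  preserving : ∀ x, MeasurePreserving (θ x) P P

/-- The Palm probability of `N` on `Ω`: `P⁰(A) = lam⁻¹ E[∫_B 1_A ∘ θ_x N(dx)]`, where `lam` is the
intensity of `N` and `B` is a bounded Borel set of volume one. -/
def palm {n : ℕ} {Ω : Type*} [MeasurableSpace Ω] (P : Measure Ω) (θ : Eucl n → Ω → Ω)
    (N : Ω → Measure (Eucl n)) (lam : ℝ) (B : Set (Eucl n)) : Measure Ω :=
  (ENNReal.ofReal lam)⁻¹ • P.bind fun ω => ((N ω).restrict B).map fun x => θ x ω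

/-- The reduced Palm expectation `E^{0,!}[N(Z)]` of the number of points of `N` in the random
set `Z`: the expectation under the Palm probability, with the point at the origin removed
from `N`. -/
def reducedPalmMean {n : ℕ} {Ω : Type*} [MeasurableSpace Ω] (P : Measure Ω) (θ : Eucl n → Ω → Ω)
    (N : Ω → Measure (Eucl n)) (lam : ℝ) (B : Set (Eucl n)) (Z : Ω → Set (Eucl n)) : ENNReal :=
  ∫⁻ ω, (N ω - Measure.dirac (0 : Eucl n) : Measure (Eucl n)) (Z ω) ∂(palm P θ N lam B)

/-- On a stationary framework in dimension `n`: Poisson data `N` of intensity `lam` and an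
independent stationary isotropic Poisson hyperplane process `X` of intensity `γ`, both compatible
with the flow. -/
structure IsPoissonCompression {n : ℕ} {Ω : Type*} [MeasurableSpace Ω] (P : Measure Ω)
    (θ : Eucl n → Ω → Ω) (N : Ω → Measure (Eucl n)) (X : Ω → Measure (Hyperplane n))
    (lam γ : ℝ) : Prop where
  framework : IsStationaryFramework P θ
  data : IsPoissonPointProcess P N lam
  hyperplanes : IsPoissonHyperplaneProcess P X γ
  indep : IndepFun N X P
  data_compatible : ∀ x ω, N (θ x ω) = (N ω).map fun y => y - x
  hyperplanes_compatible : ∀ x ω, X (θ x ω) = (X ω).map (Hyperplane.translate (-x))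


/-- The defining formula of the Palm probability: `P⁰(A) = lam⁻¹ E[∫_B 1_A ∘ θ_x N(dx)]`. -/
theorem IsPoissonCompression.palm_apply {n : ℕ} {Ω : Type*} [MeasurableSpace Ω] {P : Measure Ω}
    {θ : Eucl n → Ω → Ω} {N : Ω → Measure (Eucl n)} {X : Ω → Measure (Hyperplane n)} {lam γ : ℝ}
    (h : IsPoissonCompression P θ N X lam γ) {B : Set (Eucl n)} (hB : MeasurableSet B)
    (hBb : Bornology.IsBounded B) {A : Set Ω} (hA : MeasurableSet A) :
    palm P θ N lam B A =
      (ENNReal.ofReal lam)⁻¹ * ∫⁻ ω, ∫⁻ x in B, A.indicator 1 (θ x ω) ∂(N ω) ∂P := by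
  have hN := h.data.poisson.measurable
  have hθ := h.framework.measurable
  have hθ1 : ∀ ω, Measurable fun x => θ x ω := fun ω => hθ.comp measurable_prodMk_right
  obtain ⟨R, hR⟩ := hBb.subset_closedBall 0
  set K := Metric.closedBall (0 : Eucl n) R
  have hK : MeasurableSet K := measurableSet_closedBall
  have hNK : Measurable fun ω => N ω K := (Measure.measurable_coe hK).comp hN
  have hfin : ∀ ω, N ω K < ⊤ := fun ω => h.data.locallyFinite ω K (isCompact_closedBall _ _)
  have hκm : Measurable fun ω => (1 + N ω K)⁻¹ • (N ω).restrict K := by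
    refine Measure.measurable_of_measurable_coe _ fun s hs => ?_
    simp only [Measure.smul_apply, Measure.restrict_apply hs, smul_eq_mul]
    exact (hNK.const_add 1).inv.mul ((Measure.measurable_coe (hs.inter hK)).comp hN)
  let κ : Kernel Ω (Eucl n) := ⟨_, hκm⟩
  have hκ : IsFiniteKernel κ := by
    refine ⟨1, by simp, fun ω => ?_⟩
    change ((1 + N ω K)⁻¹ • (N ω).restrict K) Set.univ ≤ 1
    simp only [Measure.smul_apply, Measure.restrict_apply_univ, smul_eq_mul]
    exact (mul_le_mul_right le_add_self _).trans (ENNReal.inv_mul_le_one _)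
  have hbind : Measurable fun ω => ((N ω).restrict B).map fun x => θ x ω := by
    refine Measure.measurable_of_measurable_coe _ fun s hs => ?_
    have hT : MeasurableSet {q : Ω × Eucl n | q.2 ∈ B ∧ θ q.2 q.1 ∈ s} :=
      (measurable_snd hB).inter ((hθ.comp measurable_swap) hs)
    have hm := Kernel.measurable_kernel_prodMk_left (κ := κ) hT
    convert (hNK.const_add 1).mul hm using 2 with ω
    have e : MeasurableSet (Prod.mk ω ⁻¹' {q : Ω × Eucl n | q.2 ∈ B ∧ θ q.2 q.1 ∈ s}) :=
      measurable_prodMk_left hT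
    change _ = (1 + N ω K) * ((1 + N ω K)⁻¹ • (N ω).restrict K) _
    rw [Measure.smul_apply, Measure.restrict_apply e, smul_eq_mul, ← mul_assoc,
      ENNReal.mul_inv_cancel (by simp) (by simp [(hfin ω).ne]), one_mul,
      Measure.map_apply (hθ1 ω) hs, Measure.restrict_apply (hθ1 ω hs)]
    congr 1
    ext x
    constructor
    · rintro ⟨h1, h2⟩
      exact ⟨⟨h2, h1⟩, hR h2⟩
    · rintro ⟨⟨h2, h1⟩, -⟩
      exact ⟨h1, h2⟩
  rw [palm, Measure.smul_apply, smul_eq_mul, Measure.bind_apply hA hbind.aemeasurable]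
  congr 2
  ext ω
  rw [Measure.map_apply (hθ1 ω) hA, ← lintegral_indicator_one (hθ1 ω hA)]
  rfl

end

/-! Up to its boundary, the zero cell consists of the points `y` for which no hyperplane hits the
segment from the origin to `y`. By Crofton's formula (`hyperplaneIntensity_hitting_segment`) the
number of hyperplanes hitting it is Poisson with mean `γ c_n ‖y‖`, where `c_n`, called `meanAbsInner
n`, is the spherical mean of `|⟪e, u⟫|`. The second moment measure of a Poisson process
(`bind_prod_eq`), independence and the flow then turn the Palm mean into `λ_n ∫ exp(-γ c_n ‖y‖) dy`,
which polar coordinates evaluate to `cellMean`.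

The boundary is handled by a sandwich. Call `y` visible at scale `t` if `y ≠ 0` and no hyperplane
hits the segment from `0` to `t • y`. Points visible at scale `1` lie in the zero cell, and nonzero
points of the zero cell are visible at every scale `t < 1`. Under the Palm probability `N` has
exactly one point at the origin, so the reduced mean lies between `cellMean n λ_n γ_n` and `cellMean
n λ_n (t γ_n)`. By Markov's inequality, the upper bound also controls the probability that the cell
contains a second point.

For the asymptotics, Legendre duplication puts `cellMean ^ 2` in a form with a single factorial and
ratios of Gamma values half a unit apart. Stirling's formula and log-convexity of Gamma bound it on
both sides by constants times `(cellRate ^ 2) ^ n`, and `cellRate` tends to `e^λ π / (√e t ρ)`. The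
single factor `e` left by Stirling in the square is the source of `√e`. Since `t` can be taken
arbitrarily close to `1`, the threshold is not affected by the sandwich. -/

noncomputable section

open scoped ENNReal NNReal Pointwise

/-! ### Counting measures and s-finite kernels. -/

namespace IsCountingMeasure

variable {S : Type*} [MeasurableSpace S] {μ : Measure S}

theorem exists_eq_enat (h : IsCountingMeasure μ) {A : Set S} (hA : MeasurableSet A) :
    ∃ m : ℕ∞, μ A = m := by
  obtain ⟨ι, _, p, rfl⟩ := h
  refine ⟨(p ⁻¹' A).encard, ?_⟩
  rw [Measure.sum_apply _ hA, ← ENNReal.tsum_set_one, tsum_subtype (p ⁻¹' A) (fun _ => (1 : ℝ≥0∞))]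
  refine tsum_congr fun i => ?_
  rw [Measure.dirac_apply' _ hA]
  rfl

theorem one_le (h : IsCountingMeasure μ) {A : Set S} (hA : MeasurableSet A) (h0 : μ A ≠ 0) :
    1 ≤ μ A := by
  obtain ⟨m, hm⟩ := h.exists_eq_enat hA
  rw [hm] at h0 ⊢
  have h1 : m ≠ 0 := by rintro rfl; simp at h0
  have := Order.one_le_iff_pos.2 (pos_iff_ne_zero.2 h1)
  exact_mod_cast this

/-- `A` may be uncountable and non-measurable: it misses the countable set of atoms, whose
complement is null. The zero cell is defined through hyperplanes charged one at a time, and this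
converts such pointwise information into a null set of hyperplanes. -/
theorem measure_eq_zero [MeasurableSingletonClass S] (h : IsCountingMeasure μ) {A : Set S}
    (hA : ∀ x ∈ A, μ {x} = 0) : μ A = 0 := by
  obtain ⟨ι, _, p, rfl⟩ := h
  have hsub : A ⊆ (Set.range p)ᶜ := by
    rintro x hx ⟨i, rfl⟩
    have h1 := hA _ hx
    rw [Measure.sum_apply _ (measurableSet_singleton _), ENNReal.tsum_eq_zero] at h1
    simpa using h1 i
  refine measure_mono_null hsub ?_
  rw [Measure.sum_apply _ (Set.countable_range p).measurableSet.compl, ENNReal.tsum_eq_zero]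
  intro i
  rw [Measure.dirac_apply' _ (Set.countable_range p).measurableSet.compl]
  simp

end IsCountingMeasure

/-- A kernel that is finite on the sets of a countable measurable cover is s-finite. -/
theorem Kernel.isSFiniteKernel_of_cover {T S : Type*} [MeasurableSpace T] [MeasurableSpace S]
    (κ : Kernel T S) (A : ℕ → Set S) (hA : ∀ k, MeasurableSet (A k))
    (hU : ⋃ k, A k = Set.univ) (hfin : ∀ t k, κ t (A k) < ⊤) : IsSFiniteKernel κ := by
  have hD : ∀ k, MeasurableSet (disjointed A k) := fun k => .disjointed hA k
  have hm : ∀ k, Measurable fun t => κ t (disjointed A k) := fun k => κ.measurable_coe (hD k)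
  have hfin' : ∀ t k, κ t (disjointed A k) < ⊤ := fun t k =>
    (measure_mono (disjointed_subset A k)).trans_lt (hfin t k)
  -- The mass of a piece is finite for each `t` but need not be bounded in `t`. Dividing by `1 +`
  -- mass gives a finite kernel, and a density restores the mass.
  have hηm : ∀ k, Measurable fun t =>
      (1 + κ t (disjointed A k))⁻¹ • (κ t).restrict (disjointed A k) := by
    intro k
    refine Measure.measurable_of_measurable_coe _ fun s hs => ?_
    simp only [Measure.smul_apply, Measure.restrict_apply hs, smul_eq_mul]
    exact ((hm k).const_add 1).inv.mul (κ.measurable_coe (hs.inter (hD k)))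
  let η : ℕ → Kernel T S := fun k => ⟨_, hηm k⟩
  have hη : ∀ k, IsFiniteKernel (η k) := by
    refine fun k => ⟨1, by simp, fun t => ?_⟩
    change ((1 + κ t (disjointed A k))⁻¹ • (κ t).restrict (disjointed A k)) Set.univ ≤ 1
    simp only [Measure.smul_apply, Measure.restrict_apply_univ, smul_eq_mul]
    exact (mul_le_mul_right le_add_self _).trans (ENNReal.inv_mul_le_one _)
  have hs : ∀ k, IsSFiniteKernel (Kernel.withDensity (η k)
      fun t _ => 1 + κ t (disjointed A k)) := fun k =>
    Kernel.IsSFiniteKernel.withDensity _ fun t _ => by simp [(hfin' t k).ne]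
  have e : κ = Kernel.sum fun k => Kernel.withDensity (η k)
      fun t _ => 1 + κ t (disjointed A k) := by
    ext t s hs
    rw [Kernel.sum_apply' _ _ hs]
    have : ∀ k, Kernel.withDensity (η k) (fun t _ => 1 + κ t (disjointed A k)) t s =
        (κ t).restrict (disjointed A k) s := by
      intro k
      rw [Kernel.withDensity_apply' _ (f := fun t _ => 1 + κ t (disjointed A k))
          (((hm k).const_add 1).comp measurable_fst),
        lintegral_const, Measure.restrict_apply_univ]
      change _ * ((1 + κ t (disjointed A k))⁻¹ • (κ t).restrict (disjointed A k)) s = _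
      rw [Measure.smul_apply, smul_eq_mul, ← mul_assoc,
        ENNReal.mul_inv_cancel (by simp) (by simp [(hfin' t k).ne]), one_mul]
    simp_rw [this]
    rw [← Measure.sum_apply _ hs, ← Measure.restrict_iUnion (disjoint_disjointed A) hD,
      iUnion_disjointed, hU, Measure.restrict_univ]
  rw [e]
  exact Kernel.isSFiniteKernel_sum (hκs := hs)

/-! ### Poisson moments of first and second order. -/

theorem poissonMeasure_succ (r : ℝ≥0) (m : ℕ) :
    (↑(m + 1) : ℝ≥0∞) * poissonMeasure r {m + 1} = r * poissonMeasure r {m} := by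
  rw [poissonMeasure_singleton, poissonMeasure_singleton, ← ENNReal.ofReal_natCast,
    ← ENNReal.ofReal_coe_nnreal, ← ENNReal.ofReal_mul (by positivity),
    ← ENNReal.ofReal_mul (by positivity), Nat.factorial_succ]
  congr 1
  push_cast
  field_simp
  ring

theorem tsum_poissonMeasure (r : ℝ≥0) : ∑' m, poissonMeasure r {m} = 1 := by
  have := lintegral_countable' (μ := poissonMeasure r) (fun _ => 1)
  simpa using this.symm

theorem lintegral_poissonMeasure_id (r : ℝ≥0) : ∫⁻ m : ℕ, (m : ℝ≥0∞) ∂poissonMeasure r = r := by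
  rw [lintegral_countable', tsum_eq_zero_add' ENNReal.summable]
  simp_rw [poissonMeasure_succ]
  rw [ENNReal.tsum_mul_left, tsum_poissonMeasure]
  simp

theorem lintegral_poissonMeasure_mul_self (r : ℝ≥0) :
    ∫⁻ m : ℕ, (m : ℝ≥0∞) * m ∂poissonMeasure r = r * r + r := by
  rw [lintegral_countable', tsum_eq_zero_add' ENNReal.summable]
  simp_rw [mul_assoc, poissonMeasure_succ, mul_left_comm _ (r : ℝ≥0∞)]
  rw [ENNReal.tsum_mul_left]
  simp_rw [Nat.cast_succ, add_mul, one_mul]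
  rw [ENNReal.tsum_add, ← lintegral_countable', lintegral_poissonMeasure_id, tsum_poissonMeasure]
  simp [mul_add]

/-- Two probability measures agree if they agree on the points of a countable set of full
measure. -/
theorem ext_of_singleton_of_countable {S : Type*} [MeasurableSpace S] [MeasurableSingletonClass S]
    {μ ν : Measure S} [IsProbabilityMeasure μ] [IsProbabilityMeasure ν] {D : Set S}
    (hD : D.Countable) (hν : ν Dᶜ = 0) (h : ∀ x ∈ D, μ {x} = ν {x}) : μ = ν := by
  have hsub : ∀ s ⊆ D, μ s = ν s := by
    intro s hs
    rw [← Set.biUnion_of_singleton s,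
      measure_biUnion (hD.mono hs) (fun _ _ _ _ h => by simpa using h)
        (fun _ _ => measurableSet_singleton _),
      measure_biUnion (hD.mono hs) (fun _ _ _ _ h => by simpa using h)
        (fun _ _ => measurableSet_singleton _)]
    exact tsum_congr fun x => h _ (hs x.2)
  have hμ : μ Dᶜ = 0 := by
    rw [prob_compl_eq_zero_iff hD.measurableSet] at hν ⊢
    rw [hsub D subset_rfl, hν]
  ext s -
  rw [← measure_inter_conull hμ, ← measure_inter_conull hν, hsub _ Set.inter_subset_right]

namespace IsPoissonProcess

variable {Ω S : Type*} [MeasurableSpace Ω] [MeasurableSpace S] {P : Measure Ω}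
  {ξ : Ω → Measure S} {Θ : Measure S}

/-- The process prescribes probabilities of natural values only. These already add up to one, so the
joint law in `ℝ≥0∞` is determined. Two sets suffice because only second moments are needed. -/
theorem map_pair [IsProbabilityMeasure P] (h : IsPoissonProcess P ξ Θ) {A A' : Set S} (hA : MeasurableSet A)
    (hA' : MeasurableSet A') (hd : Disjoint A A') (hf : Θ A < ⊤) (hf' : Θ A' < ⊤) :
    P.map (fun ω => (ξ ω A, ξ ω A')) =
      ((poissonMeasure (Θ A).toNNReal).prod (poissonMeasure (Θ A').toNNReal)).map
        (fun p : ℕ × ℕ => ((p.1 : ℝ≥0∞), (p.2 : ℝ≥0∞))) := by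
  have hm : Measurable fun ω => (ξ ω A, ξ ω A') :=
    ((Measure.measurable_coe hA).comp h.measurable).prodMk
      ((Measure.measurable_coe hA').comp h.measurable)
  have hc : Measurable fun p : ℕ × ℕ => ((p.1 : ℝ≥0∞), (p.2 : ℝ≥0∞)) := .of_discrete
  have := Measure.isProbabilityMeasure_map (μ := P) hm.aemeasurable
  have := Measure.isProbabilityMeasure_map
    (μ := (poissonMeasure (Θ A).toNNReal).prod (poissonMeasure (Θ A').toNNReal)) hc.aemeasurable
  refine ext_of_singleton_of_countable
    (D := Set.range fun p : ℕ × ℕ => ((p.1 : ℝ≥0∞), (p.2 : ℝ≥0∞))) (Set.countable_range _) ?_ ?_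
  · rw [Measure.map_apply hc (Set.countable_range _).measurableSet.compl]
    refine (congrArg _ ?_).trans measure_empty
    ext p
    simp
  · rintro _ ⟨⟨m, m'⟩, rfl⟩
    rw [Measure.map_apply hm (measurableSet_singleton _),
      Measure.map_apply hc (measurableSet_singleton _)]
    have e1 : (fun ω => (ξ ω A, ξ ω A')) ⁻¹' {((m : ℝ≥0∞), (m' : ℝ≥0∞))} =
        {ω | ∀ i, ξ ω (![A, A'] i) = ![m, m'] i} := by
      ext ω
      simp [Fin.forall_fin_two]
    have e2 : (fun p : ℕ × ℕ => ((p.1 : ℝ≥0∞), (p.2 : ℝ≥0∞))) ⁻¹' {((m : ℝ≥0∞), (m' : ℝ≥0∞))} =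
        {m} ×ˢ {m'} := by
      ext p
      simp [Prod.ext_iff]
    rw [e1, e2, h.prob_eq 2 ![A, A'] ![m, m'] (by simp [Fin.forall_fin_two, hA, hA']) ?_
      (by simp [Fin.forall_fin_two, hf, hf']), Measure.prod_prod]
    · simp
    · intro i j hij
      fin_cases i <;> fin_cases j <;> simp_all [Function.onFun, hd.symm]

theorem lintegral_pair [IsProbabilityMeasure P] (h : IsPoissonProcess P ξ Θ) {A A' : Set S} (hA : MeasurableSet A)
    (hA' : MeasurableSet A') (hd : Disjoint A A') (hf : Θ A < ⊤) (hf' : Θ A' < ⊤)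
    {g : ℝ≥0∞ × ℝ≥0∞ → ℝ≥0∞} (hg : Measurable g) :
    ∫⁻ ω, g (ξ ω A, ξ ω A') ∂P = ∫⁻ m : ℕ, ∫⁻ m' : ℕ, g (m, m')
      ∂poissonMeasure (Θ A').toNNReal ∂poissonMeasure (Θ A).toNNReal := by
  have hm : Measurable fun ω => (ξ ω A, ξ ω A') :=
    ((Measure.measurable_coe hA).comp h.measurable).prodMk
      ((Measure.measurable_coe hA').comp h.measurable)
  have hc : Measurable fun p : ℕ × ℕ => ((p.1 : ℝ≥0∞), (p.2 : ℝ≥0∞)) := .of_discrete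
  rw [← lintegral_map hg hm, h.map_pair hA hA' hd hf hf', lintegral_map hg hc, lintegral_prod]
  exact (hg.comp hc).aemeasurable

theorem lintegral_single [IsProbabilityMeasure P] (h : IsPoissonProcess P ξ Θ) {A : Set S} (hA : MeasurableSet A)
    (hf : Θ A < ⊤) {g : ℝ≥0∞ → ℝ≥0∞} (hg : Measurable g) :
    ∫⁻ ω, g (ξ ω A) ∂P = ∫⁻ m : ℕ, g m ∂poissonMeasure (Θ A).toNNReal := by
  rw [h.lintegral_pair hA MeasurableSet.empty (by simp) hf (by simp) (g := fun p => g p.1)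
    (hg.comp measurable_fst)]
  simp

theorem lintegral_measure [IsProbabilityMeasure P] (h : IsPoissonProcess P ξ Θ) {A : Set S} (hA : MeasurableSet A)
    (hf : Θ A < ⊤) : ∫⁻ ω, ξ ω A ∂P = Θ A := by
  rw [h.lintegral_single hA hf (g := fun x => x) measurable_id, lintegral_poissonMeasure_id, ENNReal.coe_toNNReal hf.ne]

theorem measure_eq_zero (h : IsPoissonProcess P ξ Θ) {A : Set S} (hA : MeasurableSet A)
    (hf : Θ A < ⊤) : P {ω | ξ ω A = 0} = ENNReal.ofReal (Real.exp (-(Θ A).toReal)) := by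
  have := h.prob_eq 1 (fun _ => A) (fun _ => 0) (fun _ => hA)
    (fun i j hij => (hij (Subsingleton.elim i j)).elim) (fun _ => hf)
  simpa [poissonMeasure_singleton, ENNReal.toReal] using this

theorem lintegral_mul_of_disjoint [IsProbabilityMeasure P] (h : IsPoissonProcess P ξ Θ) {A A' : Set S}
    (hA : MeasurableSet A) (hA' : MeasurableSet A') (hd : Disjoint A A') (hf : Θ A < ⊤)
    (hf' : Θ A' < ⊤) : ∫⁻ ω, ξ ω A * ξ ω A' ∂P = Θ A * Θ A' := by
  rw [h.lintegral_pair hA hA' hd hf hf' (g := fun p => p.1 * p.2)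
    (measurable_fst.mul measurable_snd)]
  simp_rw [lintegral_const_mul _ (Measurable.of_discrete (f := fun m : ℕ => (m : ℝ≥0∞))),
    lintegral_poissonMeasure_id]
  rw [lintegral_mul_const _ (Measurable.of_discrete (f := fun m : ℕ => (m : ℝ≥0∞))),
    lintegral_poissonMeasure_id, ENNReal.coe_toNNReal hf.ne, ENNReal.coe_toNNReal hf'.ne]

theorem lintegral_mul_self [IsProbabilityMeasure P] (h : IsPoissonProcess P ξ Θ) {A : Set S}
    (hA : MeasurableSet A) (hf : Θ A < ⊤) : ∫⁻ ω, ξ ω A * ξ ω A ∂P = Θ A * Θ A + Θ A := by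
  rw [h.lintegral_single hA hf (g := fun p => p * p) (measurable_id.mul measurable_id),
    lintegral_poissonMeasure_mul_self, ENNReal.coe_toNNReal hf.ne]

/-- Cut `A` and `A'` into `A \ A'`, `A' \ A` and `A ∩ A'`. Products of masses of different pieces
factor by independence; only the square of the mass of `A ∩ A'` adds a Poisson variance. -/
theorem lintegral_mul [IsProbabilityMeasure P] (h : IsPoissonProcess P ξ Θ) {A A' : Set S}
    (hA : MeasurableSet A) (hA' : MeasurableSet A') (hf : Θ A < ⊤) (hf' : Θ A' < ⊤) :
    ∫⁻ ω, ξ ω A * ξ ω A' ∂P = Θ A * Θ A' + Θ (A ∩ A') := by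
  have hm : ∀ {s : Set S}, MeasurableSet s → Measurable fun ω => ξ ω s := fun hs =>
    (Measure.measurable_coe hs).comp h.measurable
  have m1 := hA.diff hA'
  have m2 := hA'.diff hA
  have m3 := hA.inter hA'
  have f1 : Θ (A \ A') < ⊤ := (measure_mono Set.sdiff_subset).trans_lt hf
  have f2 : Θ (A' \ A) < ⊤ := (measure_mono Set.sdiff_subset).trans_lt hf'
  have f3 : Θ (A ∩ A') < ⊤ := (measure_mono Set.inter_subset_left).trans_lt hf
  have e : ∀ μ : Measure S, μ A = μ (A \ A') + μ (A ∩ A') := fun μ => by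
    rw [add_comm, measure_inter_add_sdiff _ hA']
  have e' : ∀ μ : Measure S, μ A' = μ (A' \ A) + μ (A ∩ A') := fun μ => by
    rw [add_comm, Set.inter_comm, measure_inter_add_sdiff _ hA]
  have q1 := hm m1
  have q2 := hm m2
  have q3 := hm m3
  have d1 : Disjoint (A \ A') (A' \ A) := disjoint_sdiff_sdiff
  have d2 : Disjoint (A \ A') (A ∩ A') := Set.disjoint_sdiff_inter
  have d3 : Disjoint (A ∩ A') (A' \ A) := by
    rw [Set.inter_comm]; exact Set.disjoint_sdiff_inter.symm
  calc ∫⁻ ω, ξ ω A * ξ ω A' ∂P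
      = ∫⁻ ω, (ξ ω (A \ A') * ξ ω (A' \ A) + ξ ω (A \ A') * ξ ω (A ∩ A')) +
          (ξ ω (A ∩ A') * ξ ω (A' \ A) + ξ ω (A ∩ A') * ξ ω (A ∩ A')) ∂P := by
        refine lintegral_congr fun ω => ?_
        rw [e (ξ ω), e' (ξ ω)]
        ring
    _ = (Θ (A \ A') * Θ (A' \ A) + Θ (A \ A') * Θ (A ∩ A')) +
          (Θ (A ∩ A') * Θ (A' \ A) + (Θ (A ∩ A') * Θ (A ∩ A') + Θ (A ∩ A'))) := by
        rw [lintegral_add_left (by fun_prop), lintegral_add_left (by fun_prop),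
          lintegral_add_left (by fun_prop),
          h.lintegral_mul_of_disjoint m1 m2 d1 f1 f2, h.lintegral_mul_of_disjoint m1 m3 d2 f1 f3,
          h.lintegral_mul_of_disjoint m3 m2 d3 f3 f2, h.lintegral_mul_self m3 f3]
    _ = Θ A * Θ A' + Θ (A ∩ A') := by
        rw [e Θ, e' Θ]
        ring

end IsPoissonProcess

/-! ### Random measures as kernels, and Campbell formulas. -/

/-- Measures that are finite on each of the sets `A k`. -/
abbrev FiniteOn {S : Type*} [MeasurableSpace S] (A : ℕ → Set S) : Type _ :=
  {ν : Measure S // ∀ k, ν (A k) < ⊤}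

/-- The kernel that maps a measure to itself. -/
def FiniteOn.kernel {S : Type*} [MeasurableSpace S] (A : ℕ → Set S) : Kernel (FiniteOn A) S :=
  ⟨Subtype.val, measurable_subtype_coe⟩

/-- Finiteness on the cover is built into the parameter space, so the tautological kernel is
s-finite and Fubini applies to integrals against a random measure. -/
theorem FiniteOn.isSFiniteKernel_kernel {S : Type*} [MeasurableSpace S] {A : ℕ → Set S}
    (hA : ∀ k, MeasurableSet (A k)) (hU : ⋃ k, A k = Set.univ) :
    IsSFiniteKernel (FiniteOn.kernel A) :=
  Kernel.isSFiniteKernel_of_cover _ A hA hU fun ν k => ν.2 k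

/-- Campbell's formula with an independent mark. -/
theorem lintegral_kernel_of_indepFun {Ω 𝒩 ℋ T : Type*} [MeasurableSpace Ω] [MeasurableSpace 𝒩]
    [MeasurableSpace ℋ] [MeasurableSpace T] {P : Measure Ω} [IsProbabilityMeasure P]
    {N : Ω → 𝒩} {X : Ω → ℋ} (hN : Measurable N) (hX : Measurable X) (hi : IndepFun N X P)
    (κ : Kernel 𝒩 T) [IsSFiniteKernel κ] {g : ℋ × T → ℝ≥0∞} (hg : Measurable g) :
    ∫⁻ ω, ∫⁻ z, g (X ω, z) ∂κ (N ω) ∂P =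
      ∫⁻ z, ∫⁻ ω, g (X ω, z) ∂P ∂(P.map N).bind κ := by
  have := Measure.isProbabilityMeasure_map (μ := P) hN.aemeasurable
  have := Measure.isProbabilityMeasure_map (μ := P) hX.aemeasurable
  have hF : Measurable fun p : 𝒩 × ℋ => ∫⁻ z, g (p.2, z) ∂κ p.1 :=
    Measurable.lintegral_kernel_prod_right (κ := κ.comap Prod.fst measurable_fst)
      (f := fun p z => g (p.2, z)) (by unfold Function.uncurry; fun_prop)
  have e1 : ∫⁻ ω, ∫⁻ z, g (X ω, z) ∂κ (N ω) ∂P =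
      ∫⁻ p : 𝒩 × ℋ, ∫⁻ z, g (p.2, z) ∂κ p.1 ∂P.map (fun ω => (N ω, X ω)) := by
    rw [lintegral_map hF (hN.prodMk hX)]
  rw [e1, (indepFun_iff_map_prod_eq_prod_map_map hN.aemeasurable hX.aemeasurable).1 hi,
    lintegral_prod_symm _ hF.aemeasurable]
  -- With the independent mark frozen at `χ`, averaging the kernel over `N` leaves only its mean
  -- measure.
  have e2 : ∀ χ : ℋ, ∫⁻ ν, ∫⁻ z, g (χ, z) ∂κ ν ∂P.map N =
      ∫⁻ z, g (χ, z) ∂(P.map N).bind κ := fun χ => by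
    rw [Measure.lintegral_bind κ.measurable.aemeasurable (by fun_prop)]
  simp_rw [e2]
  rw [lintegral_lintegral_swap (by unfold Function.uncurry; fun_prop)]
  refine lintegral_congr fun z => ?_
  rw [lintegral_map (by fun_prop) hX]

theorem generateFrom_measurableSet_lt_top {S : Type*} [MeasurableSpace S] (Θ : Measure S)
    [SigmaFinite Θ] :
    MeasurableSpace.generateFrom {s | MeasurableSet s ∧ Θ s < ⊤} = ‹MeasurableSpace S› := by
  refine le_antisymm (MeasurableSpace.generateFrom_le fun s hs => hs.1) fun s hs => ?_
  rw [← Set.inter_univ s, ← iUnion_spanningSets Θ, Set.inter_iUnion]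
  refine MeasurableSet.iUnion fun k => MeasurableSpace.measurableSet_generateFrom ⟨?_, ?_⟩
  · exact MeasurableSet.inter hs (measurableSet_spanningSets Θ k)
  · exact (measure_mono Set.inter_subset_right).trans_lt (measure_spanningSets_lt_top Θ k)

namespace IsPoissonProcess

variable {Ω S 𝒩 : Type*} [MeasurableSpace Ω] [MeasurableSpace S] [MeasurableSpace 𝒩]
  {P : Measure Ω} [IsProbabilityMeasure P] {N : Ω → 𝒩} {κ : Kernel 𝒩 S} {Θ : Measure S}
  [SigmaFinite Θ]

theorem bind_eq (h : IsPoissonProcess P (fun ω => κ (N ω)) Θ) (hN : Measurable N) :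
    (P.map N).bind κ = Θ := by
  have key : ∀ s, MeasurableSet s ∧ Θ s < ⊤ → (P.map N).bind κ s = Θ s := by
    rintro s ⟨hs, hf⟩
    rw [Measure.bind_apply hs κ.measurable.aemeasurable, lintegral_map (κ.measurable_coe hs) hN,
      h.lintegral_measure hs hf]
  refine Measure.ext_of_generateFrom_of_iUnion _ (spanningSets Θ)
    (generateFrom_measurableSet_lt_top Θ).symm ?_ (iUnion_spanningSets Θ)
    (fun k => ⟨measurableSet_spanningSets Θ k, measure_spanningSets_lt_top Θ k⟩) ?_ key
  · rintro s ⟨hs, hf⟩ t ⟨ht, -⟩ -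
    exact ⟨hs.inter ht, (measure_mono Set.inter_subset_left).trans_lt hf⟩
  · intro k
    rw [key _ ⟨measurableSet_spanningSets Θ k, measure_spanningSets_lt_top Θ k⟩]
    exact (measure_spanningSets_lt_top Θ k).ne

/-- The second moment measure of a Poisson process. -/
theorem bind_prod_eq [IsSFiniteKernel κ] (h : IsPoissonProcess P (fun ω => κ (N ω)) Θ)
    (hN : Measurable N) :
    (P.map N).bind (κ ×ₖ κ) = Θ.prod Θ + Θ.map (fun x => (x, x)) := by
  have hdiag : Measurable fun x : S => (x, x) := measurable_id.prodMk measurable_id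
  set C := {s : Set S | MeasurableSet s ∧ Θ s < ⊤} with hC
  have hpi : IsPiSystem C := by
    rintro s ⟨hs, hf⟩ t ⟨ht, -⟩ -
    exact ⟨hs.inter ht, (measure_mono Set.inter_subset_left).trans_lt hf⟩
  have hsp : ∀ k, spanningSets Θ k ∈ C := fun k =>
    ⟨measurableSet_spanningSets Θ k, measure_spanningSets_lt_top Θ k⟩
  have hcs : IsCountablySpanning C := ⟨spanningSets Θ, hsp, iUnion_spanningSets Θ⟩
  -- On a rectangle the left side is a mixed second moment; its term `Θ (s ∩ t)` is the mass that
  -- the diagonal image of `Θ` gives to `s ×ˢ t`.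
  have key : ∀ s ∈ C, ∀ t ∈ C, (P.map N).bind (κ ×ₖ κ) (s ×ˢ t) = Θ s * Θ t + Θ (s ∩ t) := by
    rintro s ⟨hs, hf⟩ t ⟨ht, hf'⟩
    have hst := hs.prod ht
    rw [Measure.bind_apply hst (Kernel.measurable _).aemeasurable,
      lintegral_map (Kernel.measurable_coe _ hst) hN, ← h.lintegral_mul hs ht hf hf']
    refine lintegral_congr fun ω => ?_
    rw [Kernel.prod_apply, Measure.prod_prod]
  refine Measure.ext_of_generateFrom_of_iUnion (Set.image2 (· ×ˢ ·) C C)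
    (fun k => spanningSets Θ k ×ˢ spanningSets Θ k)
    (generateFrom_eq_prod (generateFrom_measurableSet_lt_top Θ)
      (generateFrom_measurableSet_lt_top Θ) hcs hcs).symm (hpi.prod hpi) ?_
    (fun k => ⟨_, hsp k, _, hsp k, rfl⟩) (fun k => ?_) ?_
  · rw [Set.iUnion_prod_of_monotone (monotone_spanningSets Θ) (monotone_spanningSets Θ),
      iUnion_spanningSets, Set.univ_prod_univ]
  · rw [key _ (hsp k) _ (hsp k)]
    have := (hsp k).2.ne
    simp [ENNReal.mul_eq_top, this]
  · rintro _ ⟨s, hs, t, ht, rfl⟩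
    rw [key s hs t ht, Measure.add_apply, Measure.prod_prod,
      Measure.map_apply hdiag (hs.1.prod ht.1)]
    rfl

end IsPoissonProcess

/-! ### Hyperplanes hitting a segment. -/

theorem segment_subset_cthickening {E : Type*} [NormedAddCommGroup E] [NormedSpace ℝ E]
    {x y q r : E} {ε : ℝ} (hx : dist x q ≤ ε) (hy : dist y r ≤ ε) :
    segment ℝ x y ⊆ Metric.cthickening ε (segment ℝ q r) := by
  rintro _ ⟨a, b, ha, hb, hab, rfl⟩
  refine Metric.mem_cthickening_of_dist_le _ (a • q + b • r) _ _ ⟨a, b, ha, hb, hab, rfl⟩ ?_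
  calc dist (a • x + b • y) (a • q + b • r) ≤ dist (a • x) (a • q) + dist (b • y) (b • r) :=
        dist_add_add_le _ _ _ _
    _ = a * dist x q + b * dist y r := by
        rw [dist_smul₀, dist_smul₀, Real.norm_of_nonneg ha, Real.norm_of_nonneg hb]
    _ ≤ a * ε + b * ε := by gcongr
    _ = ε := by rw [← add_mul, hab, one_mul]

theorem isCompact_segment' {E : Type*} [NormedAddCommGroup E] [NormedSpace ℝ E] (x y : E) :
    IsCompact (segment ℝ x y) := by
  rw [segment_eq_image_lineMap]
  exact isCompact_Icc.image AffineMap.lineMap_continuous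

namespace Hyperplane

variable {n : ℕ}

theorem isClosed_carrier (h : Hyperplane n) : IsClosed h.carrier := by
  obtain ⟨u, -, τ, hh⟩ := h.exists_normal
  rw [hh]
  exact isClosed_eq (by fun_prop) (by fun_prop)

theorem nonempty_carrier (h : Hyperplane n) : h.carrier.Nonempty := by
  obtain ⟨u, hu, τ, hh⟩ := h.exists_normal
  refine ⟨τ • u, ?_⟩
  rw [hh, Set.mem_ofPred_eq, inner_smul_left, real_inner_self_eq_norm_sq,
    mem_sphere_zero_iff_norm.1 hu]
  simp

theorem iUnion_hitting_closedBall :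
    ⋃ k : ℕ, hitting (Metric.closedBall (0 : Eucl n) k) = Set.univ := by
  refine Set.eq_univ_of_forall fun h => ?_
  obtain ⟨x, hx⟩ := h.nonempty_carrier
  obtain ⟨k, hk⟩ := exists_nat_ge (dist x 0)
  exact Set.mem_iUnion.2 ⟨k, x, hx, hk⟩

/-- Joint measurability in the hyperplane and both endpoints is needed since the endpoints will be
points of `N`. A hyperplane missing a compact segment misses a neighbourhood of it, so missing is
witnessed by a thickened segment with endpoints in a countable dense set. -/
theorem measurableSet_setOf_hitting_segment :
    MeasurableSet {p : Hyperplane n × Eucl n × Eucl n | p.1 ∈ hitting (segment ℝ p.2.1 p.2.2)} := by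
  obtain ⟨D, hDc, hDd⟩ := TopologicalSpace.exists_countable_dense (Eucl n)
  rw [← MeasurableSet.compl_iff]
  have e : {p : Hyperplane n × Eucl n × Eucl n | p.1 ∈ hitting (segment ℝ p.2.1 p.2.2)}ᶜ =
      ⋃ q ∈ D, ⋃ r ∈ D, ⋃ k : ℕ,
        (hitting (Metric.cthickening (1 / ((k : ℝ) + 1)) (segment ℝ q r)))ᶜ ×ˢ
          (Metric.ball q (1 / ((k : ℝ) + 1)) ×ˢ Metric.ball r (1 / ((k : ℝ) + 1))) := by
    ext ⟨h, x, y⟩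
    simp only [Set.mem_compl_iff, Set.mem_ofPred_eq, Set.mem_iUnion, Set.mem_prod, exists_prop]
    constructor
    · intro H
      have hd : Disjoint (segment ℝ x y) h.carrier := by
        rw [disjoint_comm]
        by_contra hn
        exact H (Set.not_disjoint_iff_nonempty_inter.1 hn)
      obtain ⟨δ, hδ, hdis⟩ := hd.exists_cthickenings (isCompact_segment' x y) h.isClosed_carrier
      -- Two thickenings of radius `1 / (k + 1)` are composed below, so twice this radius has to
      -- stay below `δ`.
      obtain ⟨k, hk⟩ := exists_nat_one_div_lt (half_pos hδ)
      have hkp : (0 : ℝ) < 1 / ((k : ℝ) + 1) := by positivity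
      obtain ⟨q, hq, hxq⟩ := hDd.exists_dist_lt x hkp
      obtain ⟨r, hr, hyr⟩ := hDd.exists_dist_lt y hkp
      refine ⟨q, hq, r, hr, k, ?_, hxq, hyr⟩
      rintro ⟨z, hz, hzs⟩
      refine Set.disjoint_left.1 hdis ?_ (Metric.self_subset_cthickening _ hz)
      have h1 : segment ℝ q r ⊆ Metric.cthickening (1 / ((k : ℝ) + 1)) (segment ℝ x y) :=
        segment_subset_cthickening (by rw [dist_comm]; exact hxq.le) (by rw [dist_comm]; exact hyr.le)
      have h2 := Metric.cthickening_cthickening_subset hkp.le hkp.le _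
        (Metric.cthickening_subset_of_subset _ h1 hzs)
      exact Metric.cthickening_mono (by linarith) _ h2
    · rintro ⟨q, -, r, -, k, H, hx, hy⟩ ⟨z, hz, hzs⟩
      exact H ⟨z, hz, segment_subset_cthickening (le_of_lt hx) (le_of_lt hy) hzs⟩
  rw [e]
  refine MeasurableSet.biUnion hDc fun q _ => MeasurableSet.biUnion hDc fun r _ =>
    MeasurableSet.iUnion fun k => ?_
  exact (measurableSet_hitting (isCompact_segment' q r).cthickening).compl.prod
    (measurableSet_ball.prod measurableSet_ball)

end Hyperplane

/-! ### The zero cell between two sets of visible points. -/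

section zeroCell

variable {n : ℕ} {χ : Measure (Hyperplane n)} {y : Eucl n}

/-- The segment is itself a connected set through the origin that avoids all charged hyperplanes. -/
theorem mem_zeroCell_of_hitting_segment_eq_zero
    (h : χ (Hyperplane.hitting (segment ℝ 0 y)) = 0) : y ∈ zeroCell χ := by
  refine subset_closure ((convex_segment 0 y).isPreconnected.subset_connectedComponentIn
    (left_mem_segment ℝ 0 y) ?_ (right_mem_segment ℝ 0 y))
  intro z hz hzU
  simp only [Set.mem_iUnion] at hzU
  obtain ⟨g, hg, hzg⟩ := hzU
  exact hg (measure_mono_null (Set.singleton_subset_iff.2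
    (show g ∈ Hyperplane.hitting (segment ℝ 0 y) from ⟨z, hzg, hz⟩)) h)

/-- The affine function of a charged hyperplane has constant strict sign on the component of the
origin, hence weak sign on its closure. For `t < 1` each point of the shortened segment is a convex
combination of `0` and `y` with positive weight at `0`, so the sign there is strict again. -/
theorem hitting_segment_smul_eq_zero_of_mem_zeroCell (hχ : IsCountingMeasure χ)
    (hy : y ∈ zeroCell χ) {t : ℝ} (ht0 : 0 ≤ t) (ht1 : t < 1) :
    χ (Hyperplane.hitting (segment ℝ 0 (t • y))) = 0 := by
  refine hχ.measure_eq_zero ?_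
  rintro g ⟨z, hzg, hz⟩
  by_contra hg
  set U := (⋃ h ∈ {h : Hyperplane n | χ {h} ≠ 0}, h.carrier)ᶜ with hU
  -- If the origin lay on a charged hyperplane, the zero cell would be empty and could not contain
  -- `y`.
  have h0 : (0 : Eucl n) ∈ U := by
    by_contra h0
    rw [zeroCell, connectedComponentIn_eq_empty h0, closure_empty] at hy
    exact hy
  have hsub : connectedComponentIn U 0 ⊆ U := connectedComponentIn_subset U 0
  have hmem : (0 : Eucl n) ∈ connectedComponentIn U 0 := mem_connectedComponentIn h0
  have hg' : ∀ x ∈ connectedComponentIn U 0, x ∉ g.carrier := fun x hx hxg =>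
    hsub hx (Set.mem_biUnion (show g ∈ {h : Hyperplane n | χ {h} ≠ 0} from hg) hxg)
  obtain ⟨u, -, τ, hgc⟩ := g.exists_normal
  let f : Eucl n → ℝ := fun x => inner ℝ x u - τ
  have hf : Continuous f := by fun_prop
  have hfg : ∀ x ∈ connectedComponentIn U 0, f x ≠ 0 := fun x hx h => hg' x hx (by
    rw [hgc]
    exact sub_eq_zero.1 h)
  have hpre := isPreconnected_connectedComponentIn (F := U) (x := (0 : Eucl n))
  have hsign : connectedComponentIn U 0 ⊆ {x | 0 ≤ f x * f 0} := by
    intro x hx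
    by_contra hneg
    rw [Set.mem_ofPred_eq, not_le] at hneg
    rcases mul_neg_iff.1 hneg with ⟨h1, h2⟩ | ⟨h1, h2⟩
    · obtain ⟨w, hw, hw0⟩ := hpre.intermediate_value hmem hx hf.continuousOn ⟨h2.le, h1.le⟩
      exact hfg w hw hw0
    · obtain ⟨w, hw, hw0⟩ := hpre.intermediate_value hx hmem hf.continuousOn ⟨h1.le, h2.le⟩
      exact hfg w hw hw0
  have hfy : 0 ≤ f y * f 0 :=
    closure_minimal hsign (isClosed_le continuous_const (by fun_prop)) hy
  have hf0 : 0 < f 0 * f 0 := mul_self_pos.2 (hfg 0 hmem)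
  obtain ⟨a, b, ha, hb, hab, rfl⟩ := hz
  have hz0 : f (a • 0 + b • t • y) = 0 := by
    rw [hgc] at hzg
    exact sub_eq_zero.2 hzg
  have e : f (a • 0 + b • t • y) = (1 - b * t) * f 0 + b * t * f y := by
    simp only [f, smul_zero, zero_add, inner_smul_left, inner_zero_left, conj_trivial]
    ring
  have hbt : b * t < 1 := by nlinarith
  have : 0 < f (a • 0 + b • t • y) * f 0 := by
    rw [e]
    have h1 : 0 < (1 - b * t) * (f 0 * f 0) := mul_pos (by linarith) hf0
    have h2 : 0 ≤ b * t * (f y * f 0) := mul_nonneg (mul_nonneg hb ht0) hfy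
    nlinarith
  rw [hz0, zero_mul] at this
  exact lt_irrefl _ this

end zeroCell

/-! ### Gaussian and spherical integrals. -/

/-- Polar coordinates for the Lebesgue integral. -/
theorem lintegral_eq_lintegral_toSphere {n : ℕ} (hn : 1 ≤ n) {f : Eucl n → ℝ≥0∞}
    (hf : Measurable f) :
    ∫⁻ x, f x = ∫⁻ u : Metric.sphere (0 : Eucl n) 1, (∫⁻ r in Set.Ioi (0 : ℝ),
      ENNReal.ofReal (r ^ (n - 1)) * f (r • (u : Eucl n)))
        ∂(volume : Measure (Eucl n)).toSphere := by
  have : Nonempty (Fin n) := ⟨⟨0, hn⟩⟩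
  have hg : Measurable fun p : Metric.sphere (0 : Eucl n) 1 × Set.Ioi (0 : ℝ) =>
      f ((p.2 : ℝ) • (p.1 : Eucl n)) := by fun_prop
  have hmp := (volume : Measure (Eucl n)).measurePreserving_homeomorphUnitSphereProd
  rw [finrank_euclideanSpace, Fintype.card_fin] at hmp
  calc ∫⁻ x, f x = ∫⁻ x : ({(0 : Eucl n)}ᶜ : Set (Eucl n)), f x
          ∂(volume.comap Subtype.val) := by
        rw [lintegral_subtype_comap (measurableSet_singleton _).compl, restrict_compl_singleton]
    _ = ∫⁻ x : ({(0 : Eucl n)}ᶜ : Set (Eucl n)),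
          (fun p : Metric.sphere (0 : Eucl n) 1 × Set.Ioi (0 : ℝ) =>
            f ((p.2 : ℝ) • (p.1 : Eucl n))) (homeomorphUnitSphereProd (Eucl n) x)
          ∂(volume.comap Subtype.val) := by
        refine lintegral_congr fun x => ?_
        congr 1
        have hx : ‖(x : Eucl n)‖ ≠ 0 := norm_ne_zero_iff.2 x.2
        simp [smul_smul, hx]
    _ = ∫⁻ u : Metric.sphere (0 : Eucl n) 1, ∫⁻ r : Set.Ioi (0 : ℝ), f ((r : ℝ) • (u : Eucl n))
          ∂Measure.volumeIoiPow (n - 1) ∂(volume : Measure (Eucl n)).toSphere := by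
        rw [hmp.lintegral_comp hg, lintegral_prod _ hg.aemeasurable]
    _ = _ := by
        refine lintegral_congr fun u => ?_
        rw [Measure.volumeIoiPow, lintegral_withDensity_eq_lintegral_mul _ (by fun_prop)
          (by fun_prop)]
        exact lintegral_subtype_comap measurableSet_Ioi
          (fun r : ℝ => ENNReal.ofReal (r ^ (n - 1)) * f (r • (u : Eucl n)))

theorem lintegral_Ioi_pow_mul_exp_neg_sq (k : ℕ) :
    ∫⁻ r in Set.Ioi (0 : ℝ), ENNReal.ofReal (r ^ k * Real.exp (-r ^ 2)) =
      ENNReal.ofReal (Real.Gamma ((k + 1) / 2) / 2) := by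
  have h := integral_rpow_mul_exp_neg_rpow (p := 2) (q := k) two_pos
    (by have : (0 : ℝ) ≤ k := k.cast_nonneg
        linarith)
  have hi := integrableOn_rpow_mul_exp_neg_rpow (p := 2) (s := k)
    (by have : (0 : ℝ) ≤ k := k.cast_nonneg
        linarith) two_pos
  simp only [Real.rpow_natCast, Real.rpow_two] at h hi
  rw [← ofReal_integral_eq_lintegral_ofReal hi, h]
  · congr 1
    ring
  · filter_upwards [ae_restrict_mem measurableSet_Ioi] with r hr
    have : (0 : ℝ) < r := hr
    positivity

theorem integral_abs_mul_exp_neg_sq : ∫ s : ℝ, |s| * Real.exp (-s ^ 2) = 1 := by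
  have h := integral_comp_abs (f := fun s : ℝ => s * Real.exp (-s ^ 2))
  simp only [sq_abs] at h
  rw [h]
  have h' := integral_rpow_mul_exp_neg_rpow (p := 2) (q := 1) two_pos (by norm_num)
  simp only [Real.rpow_one, Real.rpow_two] at h'
  rw [h']
  norm_num

theorem integrable_abs_mul_exp_neg_sq : Integrable fun s : ℝ => |s| * Real.exp (-s ^ 2) := by
  refine Integrable.of_integral_ne_zero ?_
  rw [integral_abs_mul_exp_neg_sq]
  exact one_ne_zero

/-- The Gaussian integral of the modulus of a linear form. -/
theorem lintegral_abs_inner_mul_exp_neg_sq {n : ℕ} (hn : 1 ≤ n) (w : Eucl n) :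
    ∫⁻ x : Eucl n, ENNReal.ofReal (|inner ℝ w x| * Real.exp (-‖x‖ ^ 2)) =
      ENNReal.ofReal (‖w‖ * √Real.pi ^ (n - 1)) := by
  obtain ⟨m, rfl⟩ : ∃ m, n = m + 1 := ⟨n - 1, by omega⟩
  set e : Eucl (m + 1) := EuclideanSpace.single 0 1
  have he : ‖w‖ = ‖‖w‖ • e‖ := by simp [e, norm_smul]
  -- This reflection carries `w` to the first coordinate axis and preserves norm and volume, so the
  -- Gaussian integral factors over the coordinates.
  set R := (Submodule.span ℝ {w - ‖w‖ • e})ᗮ.reflection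
  have hR : R w = ‖w‖ • e := Submodule.reflection_sub he
  let f : Fin (m + 1) → ℝ → ℝ := fun i s => (if i = 0 then |s| else 1) * Real.exp (-s ^ 2)
  have hfi : ∀ i, Integrable (f i) := by
    intro i
    by_cases hi : i = 0
    · simpa [f, hi] using integrable_abs_mul_exp_neg_sq
    · simpa [f, hi] using integrable_exp_neg_mul_sq one_pos
  have hint : ∫ x : Fin (m + 1) → ℝ, ∏ i, f i (x i) = √Real.pi ^ m := by
    rw [integral_fintype_prod_volume_eq_prod, Fin.prod_univ_succ]
    have h0 : ∫ s, f 0 s = 1 := by simpa [f] using integral_abs_mul_exp_neg_sq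
    have h1 : ∀ i : Fin m, ∫ s, f i.succ s = √Real.pi := fun i => by
      simpa [f] using integral_gaussian 1
    simp [h0, h1]
  calc ∫⁻ x : Eucl (m + 1), ENNReal.ofReal (|inner ℝ w x| * Real.exp (-‖x‖ ^ 2))
      = ∫⁻ x : Eucl (m + 1), (fun y : Eucl (m + 1) =>
          ENNReal.ofReal (‖w‖ * (|y 0| * Real.exp (-‖y‖ ^ 2)))) (R x) := by
        refine lintegral_congr fun x => ?_
        have h1 : inner ℝ w x = ‖w‖ * R x 0 := by
          rw [← R.inner_map_map, hR, inner_smul_left, EuclideanSpace.inner_single_left]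
          simp
        rw [h1, abs_mul, abs_norm, mul_assoc, ← R.norm_map x]
    _ = ∫⁻ y : Eucl (m + 1), ENNReal.ofReal (‖w‖ * (|y 0| * Real.exp (-‖y‖ ^ 2))) :=
        R.measurePreserving.lintegral_comp
          (f := fun y : Eucl (m + 1) => ENNReal.ofReal (‖w‖ * (|y 0| * Real.exp (-‖y‖ ^ 2))))
          (by fun_prop)
    _ = ∫⁻ x : Fin (m + 1) → ℝ, ENNReal.ofReal (‖w‖ * ∏ i, f i (x i)) := by
        rw [← (PiLp.volume_preserving_toLp (Fin (m + 1))).lintegral_comp (by fun_prop)]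
        refine lintegral_congr fun x => ?_
        rw [Finset.prod_mul_distrib, EuclideanSpace.norm_sq_eq, ← Real.exp_sum]
        simp
    _ = ENNReal.ofReal (‖w‖ * √Real.pi ^ m) := by
        rw [← hint, ← integral_const_mul, ofReal_integral_eq_lintegral_ofReal]
        · exact (Integrable.fintype_prod hfi).const_mul _
        · refine .of_forall fun x => mul_nonneg (norm_nonneg _) (Finset.prod_nonneg fun i _ => ?_)
          refine mul_nonneg ?_ (Real.exp_nonneg _)
          split_ifs <;> positivity

/-- The mean of `|⟪e, u⟫|` over the unit sphere of `ℝⁿ`, for a unit vector `e`. -/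
def meanAbsInner (n : ℕ) : ℝ :=
  Real.Gamma (n / 2) / (√Real.pi * Real.Gamma ((n + 1) / 2))

theorem meanAbsInner_pos {n : ℕ} (hn : 1 ≤ n) : 0 < meanAbsInner n := by
  have h1 : (0 : ℝ) < n := by exact_mod_cast hn
  have := Real.Gamma_pos_of_pos (half_pos h1)
  have := Real.Gamma_pos_of_pos (show (0 : ℝ) < (n + 1) / 2 by positivity)
  unfold meanAbsInner
  positivity

theorem toSphere_volume_univ {n : ℕ} (hn : 1 ≤ n) :
    (volume : Measure (Eucl n)).toSphere Set.univ =
      ENNReal.ofReal (2 * √Real.pi ^ n / Real.Gamma (n / 2)) := by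
  have : Nonempty (Fin n) := ⟨⟨0, hn⟩⟩
  have h1 : (0 : ℝ) < n := by exact_mod_cast hn
  have hG := Real.Gamma_pos_of_pos (half_pos h1)
  rw [Measure.toSphere_apply_univ, EuclideanSpace.volume_ball, finrank_euclideanSpace,
    Fintype.card_fin, ENNReal.ofReal_one, one_pow, one_mul, ← ENNReal.ofReal_natCast,
    ← ENNReal.ofReal_mul h1.le, Real.Gamma_add_one (half_pos h1).ne']
  congr 1
  field_simp

/-- The Gaussian integral of `|⟪w, x⟫|` is read in polar coordinates: the linear form raises the
radial power from `n - 1` to `n`, which gives the factor `Γ((n + 1) / 2) / 2`. -/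
theorem lintegral_toSphere_abs_inner {n : ℕ} (hn : 1 ≤ n) (w : Eucl n) :
    (∫⁻ u : Metric.sphere (0 : Eucl n) 1, ENNReal.ofReal |inner ℝ w (u : Eucl n)|
      ∂(volume : Measure (Eucl n)).toSphere) * ENNReal.ofReal (Real.Gamma ((n + 1) / 2) / 2) =
    ENNReal.ofReal (‖w‖ * √Real.pi ^ (n - 1)) := by
  rw [← lintegral_abs_inner_mul_exp_neg_sq hn w, lintegral_eq_lintegral_toSphere hn (by fun_prop),
    ← lintegral_Ioi_pow_mul_exp_neg_sq, ← lintegral_mul_const _ (by fun_prop)]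
  refine lintegral_congr fun u => ?_
  rw [← lintegral_const_mul _ (by fun_prop)]
  refine setLIntegral_congr_fun measurableSet_Ioi fun r hr => ?_
  replace hr : (0 : ℝ) < r := hr
  have hu : ‖(u : Eucl n)‖ = 1 := mem_sphere_zero_iff_norm.1 u.2
  rw [← ENNReal.ofReal_mul (by positivity), ← ENNReal.ofReal_mul (by positivity),
    inner_smul_right, abs_mul, abs_of_pos hr, norm_smul, hu, mul_one, Real.norm_of_nonneg hr.le]
  congr 1
  obtain ⟨m, rfl⟩ : ∃ m, n = m + 1 := ⟨n - 1, by omega⟩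
  rw [Nat.add_sub_cancel]
  ring

theorem lintegral_sphereUniform_abs_inner {n : ℕ} (hn : 1 ≤ n) (w : Eucl n) :
    ∫⁻ u : Metric.sphere (0 : Eucl n) 1, ENNReal.ofReal |inner ℝ w (u : Eucl n)|
      ∂sphereUniform n = ENNReal.ofReal (meanAbsInner n * ‖w‖) := by
  have h1 : (0 : ℝ) < n := by exact_mod_cast hn
  have hG := Real.Gamma_pos_of_pos (half_pos h1)
  have hG' := Real.Gamma_pos_of_pos (show (0 : ℝ) < (n + 1) / 2 by positivity)
  have hJ := lintegral_toSphere_abs_inner hn w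
  rw [mul_comm, ← ENNReal.eq_div_iff (by simpa using hG') ENNReal.ofReal_ne_top,
    ← ENNReal.ofReal_div_of_pos (by positivity)] at hJ
  rw [sphereUniform, lintegral_smul_measure, smul_eq_mul, toSphere_volume_univ hn,
    ← ENNReal.ofReal_inv_of_pos (by positivity), hJ,
    ← ENNReal.ofReal_mul (by positivity)]
  congr 1
  obtain ⟨m, rfl⟩ : ∃ m, n = m + 1 := ⟨n - 1, by omega⟩
  rw [meanAbsInner, Nat.add_sub_cancel]
  have : √Real.pi ≠ 0 := (Real.sqrt_pos.2 Real.pi_pos).ne'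
  field_simp
  ring

theorem isProbabilityMeasure_sphereUniform {n : ℕ} (hn : 1 ≤ n) :
    IsProbabilityMeasure (sphereUniform n) := by
  have h1 : (0 : ℝ) < n := by exact_mod_cast hn
  have hG := Real.Gamma_pos_of_pos (half_pos h1)
  refine ⟨?_⟩
  rw [sphereUniform, Measure.smul_apply, smul_eq_mul, ENNReal.inv_mul_cancel _ (measure_ne_top _ _)]
  rw [toSphere_volume_univ hn]
  simp only [ne_eq, ENNReal.ofReal_eq_zero, not_le]
  positivity

theorem measurePreserving_neg_sphereUniform (n : ℕ) :
    MeasurePreserving (Neg.neg : Metric.sphere (0 : Eucl n) 1 → _) (sphereUniform n)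
      (sphereUniform n) := by
  have hm : Measurable (Neg.neg : Metric.sphere (0 : Eucl n) 1 → _) := by
    exact (continuous_neg).measurable
  refine MeasurePreserving.smul_measure ⟨hm, ?_⟩ _
  ext s hs
  rw [Measure.map_apply hm hs, Measure.toSphere_apply' _ (hm hs), Measure.toSphere_apply' _ hs,
    ← Measure.measure_neg _ (Set.Ioo (0 : ℝ) 1 • _)]
  congr 2
  ext x
  simp only [Set.mem_neg, Set.mem_smul, Set.mem_image, Set.mem_preimage]
  constructor
  · rintro ⟨r, hr, _, ⟨u, hu, rfl⟩, h⟩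
    exact ⟨r, hr, _, ⟨-u, hu, rfl⟩, by rw [coe_neg_sphere, smul_neg, h, neg_neg]⟩
  · rintro ⟨r, hr, _, ⟨u, hu, rfl⟩, h⟩
    exact ⟨r, hr, _, ⟨-u, by simpa using hu, rfl⟩, by rw [coe_neg_sphere, smul_neg, h]⟩

/-! ### Crofton's formula and the exponential integral. -/

theorem Hyperplane.ofNormal_mem_hitting_segment {n : ℕ} (x y : Eucl n)
    (p : Metric.sphere (0 : Eucl n) 1 × ℝ) :
    Hyperplane.ofNormal p ∈ Hyperplane.hitting (segment ℝ x y) ↔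
      p.2 ∈ Set.uIcc (inner ℝ x (p.1 : Eucl n)) (inner ℝ y (p.1 : Eucl n)) := by
  rw [← segment_eq_uIcc]
  have h := image_segment ℝ ((innerₗ (Eucl n)).flip (p.1 : Eucl n)).toAffineMap x y
  simp only [LinearMap.coe_toAffineMap, LinearMap.flip_apply, innerₗ_apply_apply] at h
  rw [← h]
  constructor
  · rintro ⟨z, hz, hzs⟩
    exact ⟨z, hzs, hz⟩
  · rintro ⟨z, hzs, hz⟩
    exact ⟨z, hz, hzs⟩

/-- For a direction `u`, the values `τ` of the hyperplanes meeting the segment fill the interval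
between `⟪x, u⟫` and `⟪y, u⟫`. Its length `|⟪x - y, u⟫|` is then averaged over the sphere. -/
theorem hyperplaneIntensity_hitting_segment {n : ℕ} (hn : 1 ≤ n) {γ : ℝ} (hγ : 0 < γ)
    (x y : Eucl n) :
    hyperplaneIntensity n γ (Hyperplane.hitting (segment ℝ x y)) =
      ENNReal.ofReal (γ * meanAbsInner n * ‖x - y‖) := by
  have := isProbabilityMeasure_sphereUniform hn
  have hms := Hyperplane.measurable_ofNormal
    (Hyperplane.measurableSet_hitting (isCompact_segment' x y))
  let φ : Metric.sphere (0 : Eucl n) 1 → ℝ≥0∞ := fun u =>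
    volume (Set.uIcc (inner ℝ x (u : Eucl n)) (inner ℝ y (u : Eucl n)) ∩ Set.Ioi 0)
  have hsec : ∀ u : Metric.sphere (0 : Eucl n) 1, volume.restrict (Set.Ioi (0 : ℝ))
      (Prod.mk u ⁻¹' (Hyperplane.ofNormal ⁻¹' Hyperplane.hitting (segment ℝ x y))) = φ u := by
    intro u
    rw [Measure.restrict_apply (measurable_prodMk_left hms)]
    congr 2
    ext τ
    exact Hyperplane.ofNormal_mem_hitting_segment x y (u, τ)
  have hφm : Measurable φ := by
    have := measurable_measure_prodMk_left (ν := volume.restrict (Set.Ioi (0 : ℝ))) hms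
    simpa only [hsec] using this
  -- Only `τ > 0` is counted. The part of the interval below `0` appears, reflected, for the
  -- direction `-u`.
  have hsum : ∀ u, φ u + φ (-u) = ENNReal.ofReal |inner ℝ (x - y) (u : Eucl n)| := by
    intro u
    set a := inner ℝ x (u : Eucl n)
    set b := inner ℝ y (u : Eucl n)
    have h2 : φ (-u) = volume (Set.uIcc a b \ Set.Ioi 0) := by
      have e : Set.uIcc (inner ℝ x ((-u : Metric.sphere (0 : Eucl n) 1) : Eucl n))
          (inner ℝ y ((-u : Metric.sphere (0 : Eucl n) 1) : Eucl n)) ∩ Set.Ioi 0 =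
          -(Set.uIcc a b ∩ Set.Iio 0) := by
        rw [coe_neg_sphere, inner_neg_right, inner_neg_right]
        ext τ
        simp only [Set.mem_inter_iff, Set.mem_uIcc, Set.mem_Ioi, Set.mem_neg, Set.mem_Iio]
        refine and_congr ?_ (by simp)
        constructor
        · rintro (⟨h, h'⟩ | ⟨h, h'⟩)
          · exact Or.inr ⟨by linarith, by linarith⟩
          · exact Or.inl ⟨by linarith, by linarith⟩
        · rintro (⟨h, h'⟩ | ⟨h, h'⟩)
          · exact Or.inr ⟨by linarith, by linarith⟩
          · exact Or.inl ⟨by linarith, by linarith⟩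
      change volume _ = _
      rw [e, Measure.measure_neg, Set.sdiff_eq, Set.compl_Ioi]
      exact measure_congr ((ae_eq_refl _).inter Iio_ae_eq_Iic)
    rw [h2]
    change volume (Set.uIcc a b ∩ Set.Ioi 0) + _ = _
    rw [measure_inter_add_sdiff _ measurableSet_Ioi, Real.volume_interval, inner_sub_left, abs_sub_comm]
  have hneg : ∫⁻ u, φ (-u) ∂sphereUniform n = ∫⁻ u, φ u ∂sphereUniform n :=
    (measurePreserving_neg_sphereUniform n).lintegral_comp hφm
  rw [hyperplaneIntensity, Measure.smul_apply, Measure.map_apply Hyperplane.measurable_ofNormal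
    (Hyperplane.measurableSet_hitting (isCompact_segment' x y)), Measure.prod_apply hms]
  simp_rw [hsec]
  rw [smul_eq_mul, mul_comm 2 γ, ENNReal.ofReal_mul hγ.le, mul_assoc, ENNReal.ofReal_ofNat, two_mul]
  -- The factor `2` of the intensity supplies two copies of the integral, one of which is taken at
  -- the antipode.
  nth_rewrite 2 [← hneg]
  rw [← lintegral_add_left hφm]
  simp_rw [hsum]
  rw [lintegral_sphereUniform_abs_inner hn, ← ENNReal.ofReal_mul hγ.le, mul_assoc]

theorem lintegral_exp_neg_mul_norm {n : ℕ} (hn : 1 ≤ n) {a : ℝ} (ha : 0 < a) :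
    ∫⁻ x : Eucl n, ENNReal.ofReal (Real.exp (-(a * ‖x‖))) =
      ENNReal.ofReal (√Real.pi ^ n * n.factorial / (Real.Gamma (n / 2 + 1) * a ^ n)) := by
  have h1 : (0 : ℝ) < n := by exact_mod_cast hn
  have hG := Real.Gamma_pos_of_pos (half_pos h1)
  have hGn := Real.Gamma_pos_of_pos h1
  have hI := Real.integral_rpow_mul_exp_neg_mul_Ioi h1 ha
  have hIpos : 0 < (1 / a) ^ (n : ℝ) * Real.Gamma n := by positivity
  have hint := Integrable.of_integral_ne_zero (hI ▸ hIpos.ne')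
  have hr : ∫⁻ r in Set.Ioi (0 : ℝ), ENNReal.ofReal (r ^ (n - 1)) *
      ENNReal.ofReal (Real.exp (-(a * r))) = ENNReal.ofReal ((1 / a) ^ (n : ℝ) * Real.Gamma n) := by
    rw [← hI, ofReal_integral_eq_lintegral_ofReal hint]
    · refine setLIntegral_congr_fun measurableSet_Ioi fun r hr => ?_
      have hr : (0 : ℝ) < r := hr
      rw [← ENNReal.ofReal_mul (by positivity), ← Nat.cast_pred hn, Real.rpow_natCast]
    · filter_upwards [ae_restrict_mem measurableSet_Ioi] with r hr
      have hr : (0 : ℝ) < r := hr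
      positivity
  rw [lintegral_eq_lintegral_toSphere hn (by fun_prop)]
  have : ∀ u : Metric.sphere (0 : Eucl n) 1, ∫⁻ r in Set.Ioi (0 : ℝ), ENNReal.ofReal (r ^ (n - 1)) *
      ENNReal.ofReal (Real.exp (-(a * ‖r • (u : Eucl n)‖))) =
      ENNReal.ofReal ((1 / a) ^ (n : ℝ) * Real.Gamma n) := by
    intro u
    rw [← hr]
    refine setLIntegral_congr_fun measurableSet_Ioi fun r hr => ?_
    have hr : (0 : ℝ) < r := hr
    have hu : ‖(u : Eucl n)‖ = 1 := mem_sphere_zero_iff_norm.1 u.2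
    simp only [norm_smul, hu, mul_one, Real.norm_of_nonneg hr.le]
  simp_rw [this]
  rw [lintegral_const, toSphere_volume_univ hn, ← ENNReal.ofReal_mul hIpos.le,
    Real.Gamma_add_one (half_pos h1).ne', Real.rpow_natCast]
  congr 1
  obtain ⟨m, rfl⟩ : ∃ m, n = m + 1 := ⟨n - 1, by omega⟩
  rw [Nat.cast_succ, Real.Gamma_nat_eq_factorial, Nat.factorial_succ]
  rw [one_div, inv_pow]
  push_cast at hG ⊢
  field_simp

/-! ### Palm calculus for the pair of processes. -/

/-- Locally finite measures on `ℝⁿ`. -/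
abbrev PointConf (n : ℕ) : Type :=
  FiniteOn fun k : ℕ => Metric.closedBall (0 : Eucl n) k

/-- Locally finite measures on the space of hyperplanes. -/
abbrev HyperplaneConf (n : ℕ) : Type :=
  FiniteOn fun k : ℕ => Hyperplane.hitting (Metric.closedBall (0 : Eucl n) k)

/-- The kernel of a random locally finite measure on `ℝⁿ`. -/
def PointConf.kernel (n : ℕ) : Kernel (PointConf n) (Eucl n) := FiniteOn.kernel _

/-- The kernel of a random locally finite measure on the space of hyperplanes. -/
def HyperplaneConf.kernel (n : ℕ) : Kernel (HyperplaneConf n) (Hyperplane n) := FiniteOn.kernel _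

instance (n : ℕ) : IsSFiniteKernel (PointConf.kernel n) := by
  refine FiniteOn.isSFiniteKernel_kernel (fun k => measurableSet_closedBall) ?_
  refine Set.eq_univ_of_forall fun x => ?_
  obtain ⟨k, hk⟩ := exists_nat_ge (dist x 0)
  exact Set.mem_iUnion.2 ⟨k, hk⟩

instance (n : ℕ) : IsSFiniteKernel (HyperplaneConf.kernel n) :=
  FiniteOn.isSFiniteKernel_kernel
    (fun _ => Hyperplane.measurableSet_hitting (isCompact_closedBall _ _))
    Hyperplane.iUnion_hitting_closedBall

theorem HyperplaneConf.measurable_hitting_segment {n : ℕ} :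
    Measurable fun p : HyperplaneConf n × Eucl n × Eucl n =>
      p.1.1 (Hyperplane.hitting (segment ℝ p.2.1 p.2.2)) := by
  have hs : MeasurableSet {q : (HyperplaneConf n × Eucl n × Eucl n) × Hyperplane n |
      q.2 ∈ Hyperplane.hitting (segment ℝ q.1.2.1 q.1.2.2)} :=
    (measurable_snd.prodMk (measurable_snd.comp measurable_fst))
      Hyperplane.measurableSet_setOf_hitting_segment
  exact Kernel.measurable_kernel_prodMk_left
    (κ := (HyperplaneConf.kernel n).comap Prod.fst measurable_fst) hs

theorem Hyperplane.translate_mem_hitting_segment {n : ℕ} (v x y : Eucl n) (h : Hyperplane n) :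
    Hyperplane.translate (-v) h ∈ Hyperplane.hitting (segment ℝ x y) ↔
      h ∈ Hyperplane.hitting (segment ℝ (v + x) (v + y)) := by
  rw [← segment_translate_image]
  constructor
  · rintro ⟨_, ⟨z, hz, rfl⟩, hs⟩
    exact ⟨z, hz, z + -v, hs, by simp⟩
  · rintro ⟨_, hz, z, hs, rfl⟩
    exact ⟨z, ⟨v + z, hz, by simp⟩, hs⟩

instance sigmaFinite_ofReal_smul_volume (n : ℕ) (lam : ℝ) :
    SigmaFinite (ENNReal.ofReal lam • (volume : Measure (Eucl n))) :=
  inferInstanceAs (SigmaFinite (Real.toNNReal lam • (volume : Measure (Eucl n))))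

namespace IsPoissonCompression

variable {n : ℕ} {Ω : Type*} [MeasurableSpace Ω] {P : Measure Ω} {θ : Eucl n → Ω → Ω}
  {N : Ω → Measure (Eucl n)} {X : Ω → Measure (Hyperplane n)} {lam γ : ℝ}

/-- The data as a random element of `PointConf`. -/
def pointConf (h : IsPoissonCompression P θ N X lam γ) (ω : Ω) : PointConf n :=
  ⟨N ω, fun _ => h.data.locallyFinite ω _ (isCompact_closedBall _ _)⟩

/-- The hyperplanes as a random element of `HyperplaneConf`. -/
def hyperplaneConf (h : IsPoissonCompression P θ N X lam γ) (ω : Ω) : HyperplaneConf n :=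
  ⟨X ω, fun _ => h.hyperplanes.locallyFinite ω _ (isCompact_closedBall _ _)⟩

theorem measurable_pointConf (h : IsPoissonCompression P θ N X lam γ) :
    Measurable h.pointConf :=
  h.data.poisson.measurable.subtype_mk

theorem measurable_hyperplaneConf (h : IsPoissonCompression P θ N X lam γ) :
    Measurable h.hyperplaneConf :=
  h.hyperplanes.poisson.measurable.subtype_mk

/-- A subtype carries the pulled-back `σ`-algebra, so the generated `σ`-algebras on `Ω` are those of
`N` and `X`. -/
theorem indepFun_conf (h : IsPoissonCompression P θ N X lam γ) :
    IndepFun h.pointConf h.hyperplaneConf P := by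
  have := h.indep
  rw [IndepFun_iff_Indep] at this ⊢
  convert this using 1
  · exact MeasurableSpace.comap_comp
  · exact MeasurableSpace.comap_comp

/-- The data as a kernel. -/
def dataKernel (h : IsPoissonCompression P θ N X lam γ) : Kernel Ω (Eucl n) :=
  (PointConf.kernel n).comap h.pointConf h.measurable_pointConf

instance (h : IsPoissonCompression P θ N X lam γ) : IsSFiniteKernel h.dataKernel :=
  inferInstanceAs (IsSFiniteKernel ((PointConf.kernel n).comap _ _))

theorem sFinite_data (h : IsPoissonCompression P θ N X lam γ) (ω : Ω) : SFinite (N ω) :=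
  inferInstanceAs (SFinite (h.dataKernel ω))

theorem lintegral_palm (h : IsPoissonCompression P θ N X lam γ) {B : Set (Eucl n)}
    (hB : MeasurableSet B) {f : Ω → ℝ≥0∞} (hf : Measurable f) :
    ∫⁻ ω, f ω ∂palm P θ N lam B =
      (ENNReal.ofReal lam)⁻¹ * ∫⁻ ω, ∫⁻ x in B, f (θ x ω) ∂N ω ∂P := by
  have hθ := h.framework.measurable
  have hθ1 : ∀ ω, Measurable fun x => θ x ω := fun ω => hθ.comp measurable_prodMk_right
  have hbind : Measurable fun ω => ((N ω).restrict B).map fun x => θ x ω := by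
    refine Measure.measurable_of_measurable_coe _ fun s hs => ?_
    have hT : MeasurableSet {q : Ω × Eucl n | θ q.2 q.1 ∈ s ∧ q.2 ∈ B} :=
      ((hθ.comp measurable_swap) hs).inter (measurable_snd hB)
    convert Kernel.measurable_kernel_prodMk_left (κ := h.dataKernel) hT using 2 with ω
    rw [Measure.map_apply (hθ1 ω) hs, Measure.restrict_apply (hθ1 ω hs)]
    rfl
  rw [palm, lintegral_smul_measure, Measure.lintegral_bind hbind.aemeasurable hf.aemeasurable,
    smul_eq_mul]
  congr 1
  refine lintegral_congr fun ω => ?_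
  rw [lintegral_map hf (hθ1 ω)]

theorem lintegral_data [IsProbabilityMeasure P] (h : IsPoissonCompression P θ N X lam γ)
    {g : HyperplaneConf n × Eucl n → ℝ≥0∞} (hg : Measurable g) :
    ∫⁻ ω, ∫⁻ x, g (h.hyperplaneConf ω, x) ∂N ω ∂P =
      ENNReal.ofReal lam * ∫⁻ x, ∫⁻ ω, g (h.hyperplaneConf ω, x) ∂P := by
  have hb := IsPoissonProcess.bind_eq (κ := PointConf.kernel n) h.data.poisson
    h.measurable_pointConf
  have := lintegral_kernel_of_indepFun h.measurable_pointConf h.measurable_hyperplaneConf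
    h.indepFun_conf (PointConf.kernel n) hg
  rw [hb, lintegral_smul_measure] at this
  exact this

/-- The `lam * lam` term comes from the product part of the second moment measure, the last term
from its diagonal part, where a point is paired with itself. -/
theorem lintegral_data_pair [IsProbabilityMeasure P] (h : IsPoissonCompression P θ N X lam γ)
    {g : HyperplaneConf n × Eucl n × Eucl n → ℝ≥0∞} (hg : Measurable g) :
    ∫⁻ ω, ∫⁻ x, ∫⁻ y, g (h.hyperplaneConf ω, x, y) ∂N ω ∂N ω ∂P =
      ENNReal.ofReal lam * (ENNReal.ofReal lam *
        ∫⁻ x, ∫⁻ y, ∫⁻ ω, g (h.hyperplaneConf ω, x, y) ∂P) +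
      ENNReal.ofReal lam * ∫⁻ x, ∫⁻ ω, g (h.hyperplaneConf ω, x, x) ∂P := by
  have hb := IsPoissonProcess.bind_prod_eq (κ := PointConf.kernel n) h.data.poisson
    h.measurable_pointConf
  have key := lintegral_kernel_of_indepFun h.measurable_pointConf h.measurable_hyperplaneConf
    h.indepFun_conf (PointConf.kernel n ×ₖ PointConf.kernel n) hg
  have hX := h.measurable_hyperplaneConf
  have hm : Measurable fun z : Eucl n × Eucl n => ∫⁻ ω, g (h.hyperplaneConf ω, z) ∂P :=
    Measurable.lintegral_prod_right (f := fun z ω => g (h.hyperplaneConf ω, z))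
      (by unfold Function.uncurry; fun_prop)
  rw [hb, lintegral_add_measure, lintegral_map hm (by fun_prop), lintegral_prod _ hm.aemeasurable,
    lintegral_smul_measure, lintegral_smul_measure] at key
  simp only [lintegral_smul_measure, smul_eq_mul] at key
  rw [lintegral_const_mul _ (Measurable.lintegral_prod_right hm)] at key
  rw [← key]
  refine lintegral_congr fun ω => ?_
  have := h.sFinite_data ω
  rw [Kernel.prod_apply]
  exact (lintegral_prod (μ := N ω) (ν := N ω) (fun z => g (h.hyperplaneConf ω, z))
    (by fun_prop)).symm

end IsPoissonCompression

namespace IsPoissonCompression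

variable {n : ℕ} {Ω : Type*} [MeasurableSpace Ω] {P : Measure Ω} {θ : Eucl n → Ω → Ω}
  {N : Ω → Measure (Eucl n)} {X : Ω → Measure (Hyperplane n)} {lam γ : ℝ} {B : Set (Eucl n)}

theorem data_flow_apply (h : IsPoissonCompression P θ N X lam γ) (x : Eucl n) (ω : Ω)
    {s : Set (Eucl n)} (hs : MeasurableSet s) : N (θ x ω) s = N ω {y | y - x ∈ s} := by
  rw [h.data_compatible, Measure.map_apply (by fun_prop) hs]
  rfl

theorem hyperplanes_flow_apply (h : IsPoissonCompression P θ N X lam γ) (x : Eucl n) (ω : Ω)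
    (a b : Eucl n) : X (θ x ω) (Hyperplane.hitting (segment ℝ a b)) =
      X ω (Hyperplane.hitting (segment ℝ (x + a) (x + b))) := by
  rw [h.hyperplanes_compatible, Measure.map_apply (Hyperplane.measurable_translate _)
    (Hyperplane.measurableSet_hitting (isCompact_segment' a b))]
  congr 1
  ext g
  exact Hyperplane.translate_mem_hitting_segment x a b g

theorem measure_hitting_segment_eq_zero (h : IsPoissonCompression P θ N X lam γ) (hn : 1 ≤ n)
    (hγ : 0 < γ) (x y : Eucl n) :
    P {ω | X ω (Hyperplane.hitting (segment ℝ x y)) = 0} =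
      ENNReal.ofReal (Real.exp (-(γ * meanAbsInner n * ‖x - y‖))) := by
  have := meanAbsInner_pos hn
  rw [h.hyperplanes.poisson.measure_eq_zero
    (Hyperplane.measurableSet_hitting (isCompact_segment' x y)),
    hyperplaneIntensity_hitting_segment hn hγ, ENNReal.toReal_ofReal (by positivity)]
  rw [hyperplaneIntensity_hitting_segment hn hγ]
  exact ENNReal.ofReal_lt_top

theorem lintegral_data_measure [IsProbabilityMeasure P] (h : IsPoissonCompression P θ N X lam γ)
    (hB : MeasurableSet B) (hB1 : volume B = 1) : ∫⁻ ω, N ω B ∂P = ENNReal.ofReal lam := by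
  have hΘ : (ENNReal.ofReal lam • (volume : Measure (Eucl n))) B = ENNReal.ofReal lam := by
    rw [Measure.smul_apply, hB1, smul_eq_mul, mul_one]
  rw [h.data.poisson.lintegral_measure hB (by rw [hΘ]; exact ENNReal.ofReal_lt_top), hΘ]

theorem palm_univ [IsProbabilityMeasure P] (h : IsPoissonCompression P θ N X lam γ)
    (hlam : 0 < lam) (hB : MeasurableSet B) (hB1 : volume B = 1) :
    palm P θ N lam B Set.univ = 1 := by
  have := h.lintegral_palm hB (f := fun _ => 1) measurable_const
  simp only [lintegral_const, one_mul, Measure.restrict_apply_univ] at this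
  rw [this, h.lintegral_data_measure hB hB1, ENNReal.inv_mul_cancel (by simpa using hlam)
    ENNReal.ofReal_ne_top]

theorem measurable_data_apply (h : IsPoissonCompression P θ N X lam γ)
    {s : Set (Eucl n)} (hs : MeasurableSet s) : Measurable fun ω => N ω s :=
  (Measure.measurable_coe hs).comp h.data.poisson.measurable

/-- The volume of `ℝⁿ` has no atoms when `n ≥ 1`. -/
theorem _root_.volume_singleton_eucl (hn : 1 ≤ n) (x : Eucl n) :
    (volume : Measure (Eucl n)) {x} = 0 := by
  have : Nonempty (Fin n) := ⟨⟨0, hn⟩⟩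
  exact measure_singleton x

/-- This counts pairs of points of `N` with `x = y ∈ B`. The diagonal is Lebesgue null for `n ≥ 1`,
so only the diagonal term survives, and it equals `lam * volume B`. -/
theorem lintegral_palm_atom [IsProbabilityMeasure P] (h : IsPoissonCompression P θ N X lam γ)
    (hn : 1 ≤ n) (hlam : 0 < lam) (hB : MeasurableSet B) (hB1 : volume B = 1) :
    ∫⁻ ω, N ω {0} ∂palm P θ N lam B = 1 := by
  have hm := h.measurable_data_apply (measurableSet_singleton (0 : Eucl n))
  let D : Set (HyperplaneConf n × Eucl n × Eucl n) := {p | p.2.1 ∈ B ∧ p.2.2 = p.2.1}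
  have hD : MeasurableSet D :=
    (hB.preimage (by fun_prop)).inter (measurableSet_eq_fun (by fun_prop) (by fun_prop))
  have key := h.lintegral_data_pair (g := D.indicator 1) (measurable_const.indicator hD)
  have e : ∀ ω, ∫⁻ x, ∫⁻ y, D.indicator 1 (h.hyperplaneConf ω, x, y) ∂N ω ∂N ω =
      ∫⁻ x in B, N (θ x ω) {0} ∂N ω := by
    intro ω
    rw [← lintegral_indicator hB]
    refine lintegral_congr fun x => ?_
    by_cases hx : x ∈ B
    · rw [Set.indicator_of_mem hx, h.data_flow_apply x ω (measurableSet_singleton 0)]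
      have : {y : Eucl n | y - x ∈ ({0} : Set (Eucl n))} = {x} := by
        ext y
        simp [sub_eq_zero]
      rw [this, ← lintegral_indicator_one (measurableSet_singleton x)]
      refine lintegral_congr fun y => ?_
      by_cases hy : y = x <;> simp [D, Set.indicator, hx, hy]
    · simp [D, Set.indicator, hx]
  have e1 : ∀ x : Eucl n, ∫⁻ y, ∫⁻ ω, D.indicator 1 (h.hyperplaneConf ω, x, y) ∂P = 0 := by
    intro x
    refine (lintegral_congr_ae ?_).trans lintegral_zero
    filter_upwards [measure_eq_zero_iff_ae_notMem.1 (volume_singleton_eucl hn x)] with y hy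
    have hy : y ≠ x := hy
    simp [D, Set.indicator, hy]
  have e2 : ∀ x : Eucl n, ∫⁻ ω, D.indicator 1 (h.hyperplaneConf ω, x, x) ∂P = B.indicator 1 x := by
    intro x
    by_cases hx : x ∈ B <;> simp [D, Set.indicator, hx]
  simp_rw [e, e1, e2] at key
  rw [lintegral_indicator_one hB, hB1] at key
  rw [h.lintegral_palm hB hm, key]
  simp only [lintegral_zero, mul_zero, zero_add, mul_one]
  exact ENNReal.inv_mul_cancel (by simpa using hlam) ENNReal.ofReal_ne_top

theorem ae_palm_of_forall [IsProbabilityMeasure P] (h : IsPoissonCompression P θ N X lam γ)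
    (hB : MeasurableSet B) {p : Ω → Prop} (hp : MeasurableSet {ω | p ω})
    (H : ∀ᵐ ω ∂P, ∀ᵐ x ∂(N ω).restrict B, p (θ x ω)) : ∀ᵐ ω ∂palm P θ N lam B, p ω := by
  have hpc : MeasurableSet {ω | ¬ p ω} := hp.compl
  have key := h.lintegral_palm hB (f := {ω | ¬ p ω}.indicator 1) (measurable_const.indicator hpc)
  rw [lintegral_indicator_one hpc] at key
  rw [ae_iff, key, mul_eq_zero]
  right
  refine (lintegral_congr_ae ?_).trans lintegral_zero
  filter_upwards [H] with ω hω
  refine (lintegral_congr_ae ?_).trans lintegral_zero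
  filter_upwards [hω] with x hx
  simp [Set.indicator, hx]

/-- Seen from one of its own points, `N` has mass at least one at the origin. As the mean of this
mass is one, equality holds almost surely; removing the Dirac mass therefore removes all mass at the
origin. -/
theorem ae_palm_atom [IsProbabilityMeasure P] (h : IsPoissonCompression P θ N X lam γ)
    (hn : 1 ≤ n) (hlam : 0 < lam) (hB : MeasurableSet B) (hB1 : volume B = 1) :
    ∀ᵐ ω ∂palm P θ N lam B, N ω {0} = 1 := by
  have hm := h.measurable_data_apply (measurableSet_singleton (0 : Eucl n))
  have hge : ∀ᵐ ω ∂palm P θ N lam B, 1 ≤ N ω {0} := by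
    refine h.ae_palm_of_forall hB (measurableSet_le measurable_const hm) (.of_forall fun ω => ?_)
    refine ae_restrict_of_ae ?_
    have hc := h.data.poisson.counting ω
    refine hc.measure_eq_zero fun x hx => ?_
    by_contra h0
    refine hx ?_
    rw [Set.mem_ofPred_eq, h.data_flow_apply x ω (measurableSet_singleton 0)]
    have : {y : Eucl n | y - x ∈ ({0} : Set (Eucl n))} = {x} := by
      ext y
      simp [sub_eq_zero]
    rw [this]
    exact hc.one_le (measurableSet_singleton x) h0
  have hle : ∫⁻ ω, N ω {0} ∂palm P θ N lam B ≤ ∫⁻ _, 1 ∂palm P θ N lam B := by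
    rw [h.lintegral_palm_atom hn hlam hB hB1, lintegral_one, h.palm_univ hlam hB hB1]
  have hfin : ∫⁻ _, 1 ∂palm P θ N lam B ≠ ⊤ := by
    rw [lintegral_one, h.palm_univ hlam hB hB1]
    exact ENNReal.one_ne_top
  filter_upwards [ae_eq_of_ae_le_of_lintegral_le hge hfin hm.aemeasurable hle] with ω hω
  exact hω.symm

/-- A fixed point lies on a hyperplane with probability `0`, and by independence so does each point
of `N`. This guarantees that the zero cell contains the origin. -/
theorem ae_palm_hitting_zero [IsProbabilityMeasure P] (h : IsPoissonCompression P θ N X lam γ)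
    (hn : 1 ≤ n) (hγ : 0 < γ) (hB : MeasurableSet B) :
    ∀ᵐ ω ∂palm P θ N lam B, X ω (Hyperplane.hitting (segment ℝ 0 0)) = 0 := by
  have hseg : MeasurableSet (Hyperplane.hitting (segment ℝ (0 : Eucl n) 0)) :=
    Hyperplane.measurableSet_hitting (isCompact_segment' 0 0)
  refine h.ae_palm_of_forall hB (measurableSet_eq_fun
    ((Measure.measurable_coe hseg).comp h.hyperplanes.poisson.measurable) measurable_const) ?_
  simp_rw [h.hyperplanes_flow_apply, add_zero]
  have hm0 : Measurable fun p : HyperplaneConf n × Eucl n =>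
      p.1.1 (Hyperplane.hitting (segment ℝ p.2 p.2)) :=
    HyperplaneConf.measurable_hitting_segment.comp
      (measurable_fst.prodMk (measurable_snd.prodMk measurable_snd))
  let D : Set (HyperplaneConf n × Eucl n) :=
    {p | p.1.1 (Hyperplane.hitting (segment ℝ p.2 p.2)) ≠ 0}
  have hD : MeasurableSet D := (measurableSet_eq_fun hm0 measurable_const).compl
  have key := h.lintegral_data (g := D.indicator 1) (measurable_const.indicator hD)
  have e : ∀ x : Eucl n, ∫⁻ ω, D.indicator 1 (h.hyperplaneConf ω, x) ∂P = 0 := by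
    intro x
    have hp := h.measure_hitting_segment_eq_zero hn hγ x x
    rw [sub_self, norm_zero, mul_zero, neg_zero, Real.exp_zero, ENNReal.ofReal_one] at hp
    have hms : MeasurableSet {ω | X ω (Hyperplane.hitting (segment ℝ x x)) = 0} :=
      measurableSet_eq_fun ((Measure.measurable_coe (Hyperplane.measurableSet_hitting
        (isCompact_segment' x x))).comp h.hyperplanes.poisson.measurable) measurable_const
    rw [← prob_compl_eq_zero_iff hms] at hp
    refine (lintegral_congr_ae ?_).trans lintegral_zero
    filter_upwards [measure_eq_zero_iff_ae_notMem.1 hp] with ω hω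
    have hmem : (h.hyperplaneConf ω, x) ∉ D := fun hmem => hω hmem
    exact Set.indicator_of_notMem hmem _
  simp_rw [e, lintegral_zero, mul_zero] at key
  have hF : Measurable fun ω => ∫⁻ x, D.indicator 1 (h.hyperplaneConf ω, x) ∂N ω :=
    Measurable.lintegral_kernel_prod_right (κ := h.dataKernel)
      (f := fun ω x => D.indicator 1 (h.hyperplaneConf ω, x))
      ((measurable_const.indicator hD).comp
        ((h.measurable_hyperplaneConf.comp measurable_fst).prodMk measurable_snd))
  rw [lintegral_eq_zero_iff hF] at key
  filter_upwards [key] with ω hω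
  refine ae_restrict_of_ae ?_
  have hω : ∫⁻ x, D.indicator 1 (h.hyperplaneConf ω, x) ∂N ω = 0 := hω
  have hmx : Measurable fun x => D.indicator (1 : HyperplaneConf n × Eucl n → ℝ≥0∞) (h.hyperplaneConf ω, x) :=
    (measurable_const.indicator hD).comp measurable_prodMk_left
  rw [lintegral_eq_zero_iff hmx] at hω
  filter_upwards [hω] with x hx
  by_contra hne
  have : (h.hyperplaneConf ω, x) ∈ D := hne
  simp [this] at hx

/-- The number of points `y ≠ 0` of the data such that no hyperplane hits the segment from the
origin to `t • y`. -/
def visibleCount (N : Ω → Measure (Eucl n)) (X : Ω → Measure (Hyperplane n)) (t : ℝ) (ω : Ω) :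
    ℝ≥0∞ :=
  N ω {y | y ≠ 0 ∧ X ω (Hyperplane.hitting (segment ℝ 0 (t • y))) = 0}

theorem measurableSet_visible (h : IsPoissonCompression P θ N X lam γ) (t : ℝ) :
    MeasurableSet {q : Ω × Eucl n |
      q.2 ≠ 0 ∧ X q.1 (Hyperplane.hitting (segment ℝ 0 (t • q.2))) = 0} := by
  have hm : Measurable fun q : Ω × Eucl n =>
      X q.1 (Hyperplane.hitting (segment ℝ 0 (t • q.2))) :=
    HyperplaneConf.measurable_hitting_segment.comp
      ((h.measurable_hyperplaneConf.comp measurable_fst).prodMk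
        (measurable_const.prodMk (measurable_snd.const_smul t)))
  exact (measurableSet_eq_fun measurable_snd measurable_const).compl.inter
    (measurableSet_eq_fun hm measurable_const)

theorem measurable_visibleCount (h : IsPoissonCompression P θ N X lam γ) (t : ℝ) :
    Measurable (visibleCount N X t) :=
  Kernel.measurable_kernel_prodMk_left (κ := h.dataKernel) (h.measurableSet_visible t)

/-- The flow moves the origin to `x ∈ B`, so the count runs over pairs `x ≠ y` with an unhit segment
from `x` to `x + t • (y - x)`. The diagonal term vanishes; in the product term, translation
invariance makes the inner integral independent of `x`, and one factor `lam` cancels against the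
Palm normalization. -/
theorem lintegral_visibleCount [IsProbabilityMeasure P] (h : IsPoissonCompression P θ N X lam γ)
    (hn : 1 ≤ n) (hlam : 0 < lam) (hγ : 0 < γ) (hB : MeasurableSet B) (hB1 : volume B = 1)
    {t : ℝ} (ht : 0 < t) :
    ∫⁻ ω, visibleCount N X t ω ∂palm P θ N lam B = ENNReal.ofReal lam *
      ∫⁻ y : Eucl n, ENNReal.ofReal (Real.exp (-(t * γ * meanAbsInner n * ‖y‖))) := by
  let D : Set (HyperplaneConf n × Eucl n × Eucl n) := {p | p.2.1 ∈ B ∧ p.2.2 ≠ p.2.1 ∧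
    p.1.1 (Hyperplane.hitting (segment ℝ p.2.1 (p.2.1 + t • (p.2.2 - p.2.1)))) = 0}
  have hm0 : Measurable fun p : HyperplaneConf n × Eucl n × Eucl n =>
      p.1.1 (Hyperplane.hitting (segment ℝ p.2.1 (p.2.1 + t • (p.2.2 - p.2.1)))) :=
    HyperplaneConf.measurable_hitting_segment.comp
      (measurable_fst.prodMk (by fun_prop : Measurable fun p : HyperplaneConf n × Eucl n × Eucl n =>
        (p.2.1, p.2.1 + t • (p.2.2 - p.2.1))))
  have hD : MeasurableSet D :=
    (hB.preimage (by fun_prop)).inter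
      ((measurableSet_eq_fun (by fun_prop) (by fun_prop)).compl.inter
        (measurableSet_eq_fun hm0 measurable_const))
  have key := h.lintegral_data_pair (g := D.indicator 1) (measurable_const.indicator hD)
  have e : ∀ ω, ∫⁻ x, ∫⁻ y, D.indicator 1 (h.hyperplaneConf ω, x, y) ∂N ω ∂N ω =
      ∫⁻ x in B, visibleCount N X t (θ x ω) ∂N ω := by
    intro ω
    rw [← lintegral_indicator hB]
    refine lintegral_congr fun x => ?_
    have hDx : MeasurableSet {y | (h.hyperplaneConf ω, x, y) ∈ D} :=
      measurable_prodMk_left (measurable_prodMk_left hD)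
    have hl : ∫⁻ y, D.indicator 1 (h.hyperplaneConf ω, x, y) ∂N ω =
        N ω {y | (h.hyperplaneConf ω, x, y) ∈ D} := lintegral_indicator_one hDx
    have hV : MeasurableSet {y | y ≠ 0 ∧
        X (θ x ω) (Hyperplane.hitting (segment ℝ 0 (t • y))) = 0} :=
      measurable_prodMk_left (h.measurableSet_visible t)
    rw [hl]
    by_cases hx : x ∈ B
    · rw [Set.indicator_of_mem hx, visibleCount, h.data_flow_apply x ω hV]
      congr 1
      ext y
      simp only [Set.mem_ofPred_eq, h.hyperplanes_flow_apply, add_zero, sub_ne_zero]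
      exact ⟨fun hy => hy.2, fun hy => ⟨hx, hy⟩⟩
    · rw [Set.indicator_of_notMem hx]
      refine (congrArg _ ?_).trans measure_empty
      ext y
      simp [D, hx]
  have e1 : ∀ x : Eucl n, ∫⁻ y, ∫⁻ ω, D.indicator 1 (h.hyperplaneConf ω, x, y) ∂P =
      B.indicator (fun _ => ∫⁻ y : Eucl n,
        ENNReal.ofReal (Real.exp (-(t * γ * meanAbsInner n * ‖y‖)))) x := by
    intro x
    by_cases hx : x ∈ B
    · rw [Set.indicator_of_mem hx, ← lintegral_sub_right_eq_self
        (fun y => ENNReal.ofReal (Real.exp (-(t * γ * meanAbsInner n * ‖y‖)))) x]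
      refine lintegral_congr_ae ?_
      filter_upwards [measure_eq_zero_iff_ae_notMem.1 (volume_singleton_eucl hn x)] with y hy
      have hy : y ≠ x := hy
      have hl : ∫⁻ ω, D.indicator 1 (h.hyperplaneConf ω, x, y) ∂P =
          P {ω | (h.hyperplaneConf ω, x, y) ∈ D} :=
        lintegral_indicator_one ((h.measurable_hyperplaneConf.prodMk measurable_const) hD)
      have hs : {ω | (h.hyperplaneConf ω, x, y) ∈ D} =
          {ω | X ω (Hyperplane.hitting (segment ℝ x (x + t • (y - x)))) = 0} := by
        ext ω
        exact ⟨fun hy => hy.2.2, fun h0 => ⟨hx, hy, h0⟩⟩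
      rw [hl, hs, h.measure_hitting_segment_eq_zero hn hγ, sub_add_cancel_left, norm_neg,
        norm_smul,
        Real.norm_of_nonneg ht.le]
      congr 3
      ring
    · rw [Set.indicator_of_notMem hx]
      simp [D, Set.indicator, hx]
  have e2 : ∀ x : Eucl n, ∫⁻ ω, D.indicator 1 (h.hyperplaneConf ω, x, x) ∂P = 0 := by
    intro x
    simp [D, Set.indicator]
  simp_rw [e, e1, e2] at key
  rw [lintegral_indicator hB, setLIntegral_const, hB1, lintegral_zero, mul_zero, add_zero,
    mul_one] at key
  rw [h.lintegral_palm hB (h.measurable_visibleCount t), key, ← mul_assoc,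
    ENNReal.inv_mul_cancel (by simpa using hlam) ENNReal.ofReal_ne_top, one_mul]

end IsPoissonCompression

/-! ### Bounds for the zero cell by `cellMean`. -/

/-- `lam ∫ exp(-γ c_n ‖y‖) dy`, where `c_n` is `meanAbsInner n`: the mean number of points in the
zero cell. -/
def cellMean (n : ℕ) (lam γ : ℝ) : ℝ :=
  lam * (√Real.pi ^ n * n.factorial / (Real.Gamma (n / 2 + 1) * (γ * meanAbsInner n) ^ n))

theorem dirac_le_of_singleton_eq_one {S : Type*} [MeasurableSpace S] {μ : Measure S} {x : S}
    (hx : μ {x} = 1) : Measure.dirac x ≤ μ := by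
  refine Measure.le_iff.2 fun s hs => ?_
  rw [Measure.dirac_apply' _ hs]
  by_cases h0 : x ∈ s
  · rw [Set.indicator_of_mem h0, Pi.one_apply, ← hx]
    exact measure_mono (Set.singleton_subset_iff.2 h0)
  · rw [Set.indicator_of_notMem h0]
    exact zero_le

theorem visible_subset_zeroCell {n : ℕ} (χ : Measure (Hyperplane n)) :
    {y | y ≠ 0 ∧ χ (Hyperplane.hitting (segment ℝ 0 ((1 : ℝ) • y))) = 0} ⊆ zeroCell χ := by
  rintro y ⟨-, hy⟩
  rw [one_smul] at hy
  exact mem_zeroCell_of_hitting_segment_eq_zero hy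

namespace IsPoissonCompression

variable {n : ℕ} {Ω : Type*} [MeasurableSpace Ω] {P : Measure Ω} {θ : Eucl n → Ω → Ω}
  {N : Ω → Measure (Eucl n)} {X : Ω → Measure (Hyperplane n)} {lam γ : ℝ} {B : Set (Eucl n)}

theorem lintegral_visibleCount_eq [IsProbabilityMeasure P]
    (h : IsPoissonCompression P θ N X lam γ)
    (hn : 1 ≤ n) (hlam : 0 < lam) (hγ : 0 < γ) (hB : MeasurableSet B) (hB1 : volume B = 1)
    {t : ℝ} (ht : 0 < t) :
    ∫⁻ ω, visibleCount N X t ω ∂palm P θ N lam B = ENNReal.ofReal (cellMean n lam (t * γ)) := by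
  rw [h.lintegral_visibleCount hn hlam hγ hB hB1 ht, lintegral_exp_neg_mul_norm hn
    (mul_pos (mul_pos ht hγ) (meanAbsInner_pos hn)), ← ENNReal.ofReal_mul hlam.le]
  rfl

theorem zeroCell_subset (h : IsPoissonCompression P θ N X lam γ) (ω : Ω) {t : ℝ} (ht : 0 ≤ t)
    (ht1 : t < 1) : zeroCell (X ω) ⊆
      {0} ∪ {y | y ≠ 0 ∧ X ω (Hyperplane.hitting (segment ℝ 0 (t • y))) = 0} := by
  intro y hy
  by_cases hy0 : y = 0
  · exact Or.inl hy0
  · exact Or.inr ⟨hy0, hitting_segment_smul_eq_zero_of_mem_zeroCell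
      (h.hyperplanes.poisson.counting ω) hy ht ht1⟩

/-- Only monotonicity is used for the zero cell; the measurable set of visible points carries the
computation. The singleton `{0}` in the cover contributes nothing because `N` has unit mass there.
-/
theorem reducedPalmMean_le [IsProbabilityMeasure P] (h : IsPoissonCompression P θ N X lam γ)
    (hn : 1 ≤ n) (hlam : 0 < lam) (hγ : 0 < γ) (hB : MeasurableSet B) (hB1 : volume B = 1)
    {t : ℝ} (ht : 0 < t) (ht1 : t < 1) :
    reducedPalmMean P θ N lam B (fun ω => zeroCell (X ω)) ≤
      ENNReal.ofReal (cellMean n lam (t * γ)) := by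
  rw [← h.lintegral_visibleCount_eq hn hlam hγ hB hB1 ht, reducedPalmMean]
  refine lintegral_mono_ae ?_
  filter_upwards [h.ae_palm_atom hn hlam hB hB1] with ω hω
  have hle := dirac_le_of_singleton_eq_one hω
  refine (measure_mono (h.zeroCell_subset ω ht.le ht1)).trans ((measure_union_le _ _).trans ?_)
  rw [Measure.sub_apply (measurableSet_singleton 0) hle, hω]
  simp only [measurableSet_singleton, Measure.dirac_apply', Set.mem_singleton_iff,
    Set.indicator_of_mem, Pi.one_apply, tsub_self, zero_add]
  exact Measure.sub_le _

theorem le_reducedPalmMean [IsProbabilityMeasure P] (h : IsPoissonCompression P θ N X lam γ)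
    (hn : 1 ≤ n) (hlam : 0 < lam) (hγ : 0 < γ) (hB : MeasurableSet B) (hB1 : volume B = 1) :
    ENNReal.ofReal (cellMean n lam γ) ≤
      reducedPalmMean P θ N lam B (fun ω => zeroCell (X ω)) := by
  have := h.lintegral_visibleCount_eq hn hlam hγ hB hB1 one_pos
  rw [one_mul] at this
  rw [← this, reducedPalmMean]
  refine lintegral_mono_ae ?_
  filter_upwards [h.ae_palm_atom hn hlam hB hB1] with ω hω
  refine le_trans ?_ (measure_mono (visible_subset_zeroCell (X ω)))
  have hV : MeasurableSet {y : Eucl n | y ≠ 0 ∧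
      X ω (Hyperplane.hitting (segment ℝ 0 ((1 : ℝ) • y))) = 0} :=
    measurable_prodMk_left (h.measurableSet_visible 1)
  rw [Measure.sub_apply hV (dirac_le_of_singleton_eq_one hω), Measure.dirac_apply' _ hV]
  simp [visibleCount]

/-- If the cell does not contain exactly one point, then almost surely `visibleCount` is at least
one, and Markov's inequality applies. -/
theorem le_palm_data_zeroCell_eq_one [IsProbabilityMeasure P]
    (h : IsPoissonCompression P θ N X lam γ)
    (hn : 1 ≤ n) (hlam : 0 < lam) (hγ : 0 < γ) (hB : MeasurableSet B) (hB1 : volume B = 1)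
    {t : ℝ} (ht : 0 < t) (ht1 : t < 1) :
    1 - ENNReal.ofReal (cellMean n lam (t * γ)) ≤
      palm P θ N lam B {ω | N ω (zeroCell (X ω)) = 1} := by
  rw [← h.lintegral_visibleCount_eq hn hlam hγ hB hB1 ht, tsub_le_iff_right]
  have hu := h.palm_univ hlam hB hB1
  rw [← Set.union_compl_self {ω | N ω (zeroCell (X ω)) = 1}] at hu
  refine hu.symm.le.trans ((measure_union_le _ _).trans ?_)
  gcongr
  have hM := mul_meas_ge_le_lintegral (μ := palm P θ N lam B) (h.measurable_visibleCount t) 1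
  rw [one_mul] at hM
  refine le_trans (measure_mono_ae ?_) hM
  filter_upwards [h.ae_palm_atom hn hlam hB hB1, h.ae_palm_hitting_zero hn hγ hB] with ω hω h0 hne
  have hV : MeasurableSet {y : Eucl n | y ≠ 0 ∧
      X ω (Hyperplane.hitting (segment ℝ 0 (t • y))) = 0} :=
    measurable_prodMk_left (h.measurableSet_visible t)
  -- The count takes integer values, so it is enough to exclude zero. With no visible point the cell
  -- would contain the origin and no other mass of `N`.
  refine (h.data.poisson.counting ω).one_le hV fun hv => hne (le_antisymm ?_ ?_)
  · refine (measure_mono (h.zeroCell_subset ω ht.le ht1)).trans ((measure_union_le _ _).trans ?_)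
    rw [hω, hv, add_zero]
  · rw [← hω]
    exact measure_mono (Set.singleton_subset_iff.2 (mem_zeroCell_of_hitting_segment_eq_zero h0))

end IsPoissonCompression

/-! ### Gamma ratios, Stirling's formula and the threshold. -/

theorem Gamma_add_half_le {x : ℝ} (hx : 0 < x) :
    Real.Gamma (x + 1 / 2) ≤ √x * Real.Gamma x := by
  have hG := Real.Gamma_pos_of_pos hx
  -- Log-convexity of Gamma at the midpoint of `x` and `x + 1`.
  have h := Real.Gamma_mul_add_mul_le_rpow_Gamma_mul_rpow_Gamma hx
    (show (0 : ℝ) < x + 1 by linarith) (show (0 : ℝ) < 1 / 2 by norm_num)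
    (show (0 : ℝ) < 1 / 2 by norm_num) (by norm_num)
  rw [Real.Gamma_add_one hx.ne', ← Real.sqrt_eq_rpow, ← Real.sqrt_eq_rpow,
    Real.sqrt_mul hx.le, mul_left_comm, Real.mul_self_sqrt hG.le] at h
  convert h using 2
  ring

theorem le_Gamma_add_half {x : ℝ} (hx : 0 < x) :
    x * Real.Gamma x ≤ √(x + 1 / 2) * Real.Gamma (x + 1 / 2) := by
  have h := Gamma_add_half_le (show (0 : ℝ) < x + 1 / 2 by linarith)
  rwa [add_assoc, add_halves, Real.Gamma_add_one hx.ne'] at h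

theorem factorial_eq_Gamma_mul_Gamma (n : ℕ) :
    Real.Gamma ((n + 1) / 2) * Real.Gamma (n / 2 + 1) * 2 ^ n = n.factorial * √Real.pi := by
  have h := Real.Gamma_mul_Gamma_add_half ((n + 1) / 2 : ℝ)
  have e1 : ((n : ℝ) + 1) / 2 + 1 / 2 = n / 2 + 1 := by ring
  have e2 : 2 * (((n : ℝ) + 1) / 2) = n + 1 := by ring
  have e3 : (1 : ℝ) - (n + 1) = -n := by ring
  rw [e1, e2, e3, Real.Gamma_nat_eq_factorial, Real.rpow_neg two_pos.le, Real.rpow_natCast] at h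
  rw [h]
  field_simp

/-- After squaring, duplication replaces one of the two factorials, so that the `Γ(n / 2 + 1)`
factors leave just one ratio to be bounded and Stirling is needed for one factorial only. -/
theorem cellMean_sq {n : ℕ} (hn : 1 ≤ n) (l g : ℝ) (hg : 0 < g) :
    cellMean n l g ^ 2 = l ^ 2 * (2 * Real.pi ^ 2 *
      (Real.Gamma ((n + 1) / 2) / Real.Gamma (n / 2)) ^ 2) ^ n * n.factorial /
      (√Real.pi * (Real.Gamma (n / 2 + 1) / Real.Gamma ((n + 1) / 2)) * (g ^ 2) ^ n) := by
  have h1 : (0 : ℝ) < n := by exact_mod_cast hn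
  have hF := factorial_eq_Gamma_mul_Gamma n
  have ha := Real.Gamma_pos_of_pos (half_pos h1)
  have hb := Real.Gamma_pos_of_pos (show (0 : ℝ) < (n + 1) / 2 by positivity)
  have hc := Real.Gamma_pos_of_pos (show (0 : ℝ) < (n : ℝ) / 2 + 1 by positivity)
  rw [cellMean, meanAbsInner]
  set a := Real.Gamma ((n : ℝ) / 2)
  set b := Real.Gamma (((n : ℝ) + 1) / 2)
  set c := Real.Gamma ((n : ℝ) / 2 + 1)
  have hpi : 0 < √Real.pi := Real.sqrt_pos.2 Real.pi_pos
  have hpi2 : Real.pi = √Real.pi ^ 2 := (Real.sq_sqrt Real.pi_pos.le).symm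
  set p := √Real.pi
  rw [hpi2]
  have hf : (n.factorial : ℝ) = b * c * 2 ^ n / p := by
    rw [eq_div_iff hpi.ne', hF]
  rw [hf]
  simp only [mul_pow, div_pow]
  field_simp
  ring

theorem factorial_eq_stirlingSeq {n : ℕ} (hn : 1 ≤ n) :
    (n.factorial : ℝ) = Stirling.stirlingSeq n * (√(2 * n) * (n / Real.exp 1) ^ n) := by
  have h1 : (0 : ℝ) < n := by exact_mod_cast hn
  rw [Stirling.stirlingSeq]
  field_simp

/-- The geometric rate of `cellMean n (μ ^ n) g`. -/
def cellRate (n : ℕ) (μ g : ℝ) : ℝ := μ * Real.pi * n / (√(Real.exp 1) * g)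

theorem cellRate_sq_pow (n : ℕ) (μ g : ℝ) : (cellRate n μ g ^ 2) ^ n =
    (μ ^ n) ^ 2 * (Real.pi ^ 2 * n) ^ n * (n / Real.exp 1) ^ n / (g ^ 2) ^ n := by
  rw [cellRate, div_pow, mul_pow √_, Real.sq_sqrt (Real.exp_pos 1).le]
  simp only [mul_pow, div_pow]
  field_simp
  ring

/-- The Stirling sequence is bounded by `K`, and `√(2 n)` exceeds the bound `√(n / 2)` of the Gamma
ratio by the factor `2`; hence the constant `2 K / √π`. -/
theorem exists_cellMean_sq_le : ∃ K : ℝ, ∀ n : ℕ, 1 ≤ n → ∀ μ g : ℝ, 0 < g →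
    cellMean n (μ ^ n) g ^ 2 ≤ K * (cellRate n μ g ^ 2) ^ n := by
  obtain ⟨K, hK⟩ := Stirling.tendsto_stirlingSeq_sqrt_pi.bddAbove_range
  refine ⟨2 * K / √Real.pi, fun n hn μ g hg => ?_⟩
  have h1 : (0 : ℝ) < n := by exact_mod_cast hn
  have ha := Real.Gamma_pos_of_pos (half_pos h1)
  have hb := Real.Gamma_pos_of_pos (show (0 : ℝ) < (n + 1) / 2 by positivity)
  have hc := Real.Gamma_pos_of_pos (show (0 : ℝ) < (n : ℝ) / 2 + 1 by positivity)
  have hpi : 0 < √Real.pi := Real.sqrt_pos.2 Real.pi_pos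
  have hS : Stirling.stirlingSeq n ≤ K := hK ⟨n, rfl⟩
  have hS0 : 0 ≤ Stirling.stirlingSeq n := by unfold Stirling.stirlingSeq; positivity
  have hK0 : 0 ≤ K := hS0.trans hS
  have hR : (Real.Gamma ((n + 1) / 2) / Real.Gamma (n / 2)) ^ 2 ≤ n / 2 := by
    have h := Gamma_add_half_le (half_pos h1)
    rw [← add_div, ← div_le_iff₀ ha] at h
    calc _ ≤ √((n : ℝ) / 2) ^ 2 := by gcongr
      _ = n / 2 := Real.sq_sqrt (by positivity)
  have hR' : √((n : ℝ) / 2) ≤ Real.Gamma (n / 2 + 1) / Real.Gamma ((n + 1) / 2) := by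
    have h := le_Gamma_add_half (show (0 : ℝ) < (n + 1) / 2 by positivity)
    have e : ((n : ℝ) + 1) / 2 + 1 / 2 = n / 2 + 1 := by ring
    rw [e] at h
    rw [le_div_iff₀ hb]
    have hs : 0 < √((n : ℝ) / 2 + 1) := Real.sqrt_pos.2 (by positivity)
    refine le_of_mul_le_mul_left (le_trans ?_ h) hs
    rw [← mul_assoc, ← Real.sqrt_mul (by positivity)]
    refine mul_le_mul_of_nonneg_right ?_ hb.le
    refine Real.sqrt_le_iff.2 ⟨by positivity, ?_⟩
    -- The inequality is `(n / 2) (n / 2 + 1) ≤ ((n + 1) / 2) ^ 2`.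
    nlinarith
  rw [cellMean_sq hn _ _ hg, cellRate_sq_pow, factorial_eq_stirlingSeq hn]
  have h2n : √(2 * (n : ℝ)) = 2 * √((n : ℝ) / 2) := by
    rw [show 2 * (n : ℝ) = 2 ^ 2 * (n / 2) by ring, Real.sqrt_mul (by positivity),
      Real.sqrt_sq two_pos.le]
  have hs : 0 < √((n : ℝ) / 2) := Real.sqrt_pos.2 (by positivity)
  calc _ ≤ (μ ^ n) ^ 2 * (2 * Real.pi ^ 2 * (n / 2)) ^ n *
        (K * (√(2 * n) * (n / Real.exp 1) ^ n)) / (√Real.pi * √((n : ℝ) / 2) * (g ^ 2) ^ n) := by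
        gcongr
    _ = _ := by
        rw [h2n, show 2 * Real.pi ^ 2 * ((n : ℝ) / 2) = Real.pi ^ 2 * n by ring]
        field_simp

/-- The lower bound for the Gamma ratio loses a factor `n / (n + 1)`, whose `n`-th power is at least
`exp (-1)`. The crude `√(2 n)` bounding the other ratio cancels the root in Stirling's formula. -/
theorem le_cellMean_sq {n : ℕ} (hn : 1 ≤ n) {μ g : ℝ} (hg : 0 < g) :
    Real.exp (-1) * (cellRate n μ g ^ 2) ^ n ≤ cellMean n (μ ^ n) g ^ 2 := by
  have h1 : (1 : ℝ) ≤ n := by exact_mod_cast hn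
  have h0 : (0 : ℝ) < n := by linarith
  have ha := Real.Gamma_pos_of_pos (half_pos h0)
  have hb := Real.Gamma_pos_of_pos (show (0 : ℝ) < (n + 1) / 2 by positivity)
  have hc := Real.Gamma_pos_of_pos (show (0 : ℝ) < (n : ℝ) / 2 + 1 by positivity)
  have hpi : 0 < √Real.pi := Real.sqrt_pos.2 Real.pi_pos
  have hR : n / 2 * (n / (n + 1)) ≤ (Real.Gamma ((n + 1) / 2) / Real.Gamma (n / 2)) ^ 2 := by
    have h := le_Gamma_add_half (half_pos h0)
    rw [← add_div, ← le_div_iff₀ ha, mul_div_assoc] at h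
    have hs : 0 < √(((n : ℝ) + 1) / 2) := Real.sqrt_pos.2 (by positivity)
    have h2 := pow_le_pow_left₀ (by positivity) h 2
    rw [mul_pow, Real.sq_sqrt (by positivity)] at h2
    refine le_of_mul_le_mul_left (le_trans (le_of_eq ?_) h2)
      (show (0 : ℝ) < (n + 1) / 2 by positivity)
    field_simp
  have hR' : Real.Gamma (n / 2 + 1) / Real.Gamma ((n + 1) / 2) ≤ √(2 * n) := by
    have h := Gamma_add_half_le (show (0 : ℝ) < (n + 1) / 2 by positivity)
    have e : ((n : ℝ) + 1) / 2 + 1 / 2 = n / 2 + 1 := by ring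
    rw [e, ← div_le_iff₀ hb] at h
    refine h.trans (Real.sqrt_le_sqrt ?_)
    linarith
  have hexp : Real.exp (-1) ≤ ((n : ℝ) / (n + 1)) ^ n := by
    have h := pow_le_pow_left₀ (by positivity) (Real.add_one_le_exp (1 / (n : ℝ))) n
    rw [← Real.exp_nat_mul, mul_one_div_cancel h0.ne'] at h
    rw [Real.exp_neg, inv_le_comm₀ (Real.exp_pos 1) (by positivity), ← inv_pow]
    convert h using 2
    field_simp
    ring
  have hF : √Real.pi * (√(2 * n) * (n / Real.exp 1) ^ n) ≤ n.factorial := by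
    rw [factorial_eq_stirlingSeq hn]
    gcongr
    exact Stirling.sqrt_pi_le_stirlingSeq (by omega)
  rw [cellMean_sq hn _ _ hg, cellRate_sq_pow]
  have hs : 0 < √(2 * (n : ℝ)) := Real.sqrt_pos.2 (by positivity)
  calc _ ≤ ((n : ℝ) / (n + 1)) ^ n * ((μ ^ n) ^ 2 * (Real.pi ^ 2 * n) ^ n *
        (n / Real.exp 1) ^ n / (g ^ 2) ^ n) := by
        gcongr
    _ = (μ ^ n) ^ 2 * (2 * Real.pi ^ 2 * (n / 2 * (n / (n + 1)))) ^ n *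
        (√Real.pi * (√(2 * n) * (n / Real.exp 1) ^ n)) /
          (√Real.pi * √(2 * n) * (g ^ 2) ^ n) := by
        rw [show 2 * Real.pi ^ 2 * ((n : ℝ) / 2 * (n / (n + 1))) =
          (n / (n + 1)) * (Real.pi ^ 2 * n) by ring, mul_pow (_ / _)]
        field_simp
    _ ≤ _ := by
        gcongr

theorem tendsto_cellMean_zero {μ g : ℕ → ℝ} {b : ℝ} (hb : b < 1) (hμ : ∀ n, 1 ≤ n → 0 < μ n)
    (hg : ∀ n, 1 ≤ n → 0 < g n)
    (h : Tendsto (fun n => cellRate n (μ n) (g n)) atTop (𝓝 b)) :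
    Tendsto (fun n => cellMean n (μ n ^ n) (g n)) atTop (𝓝 0) := by
  obtain ⟨K, hK⟩ := exists_cellMean_sq_le
  have hb0 : 0 ≤ b := ge_of_tendsto h (by
    filter_upwards [eventually_ge_atTop 1] with n hn
    have := hμ n hn
    have := hg n hn
    unfold cellRate
    positivity)
  obtain ⟨q, hbq, hq1⟩ := exists_between hb
  have hq0 : 0 ≤ q := hb0.trans hbq.le
  have hlim : Tendsto (fun n : ℕ => |K| * (q ^ 2) ^ n) atTop (𝓝 0) := by
    have := (tendsto_pow_atTop_nhds_zero_of_lt_one (sq_nonneg q)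
      (by nlinarith : q ^ 2 < 1)).const_mul |K|
    rwa [mul_zero] at this
  have hsq : Tendsto (fun n => cellMean n (μ n ^ n) (g n) ^ 2) atTop (𝓝 0) := by
    refine squeeze_zero' (.of_forall fun n => sq_nonneg _) ?_ hlim
    filter_upwards [eventually_ge_atTop 1, h.eventually_lt_const hbq] with n hn hlt
    have h1 := hμ n hn
    have h2 := hg n hn
    have hr : 0 ≤ cellRate n (μ n) (g n) := by
      unfold cellRate
      positivity
    refine (hK n hn _ _ h2).trans ?_
    gcongr
    exact le_abs_self K
  have := (Real.continuous_sqrt.tendsto 0).comp hsq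
  rw [Real.sqrt_zero] at this
  refine squeeze_zero_norm (fun n => ?_) this
  rw [Function.comp_apply, Real.sqrt_sq_eq_abs, Real.norm_eq_abs]

theorem tendsto_cellMean_atTop {μ g : ℕ → ℝ} {b : ℝ} (hb : 1 < b) (hμ : ∀ n, 1 ≤ n → 0 < μ n)
    (hg : ∀ n, 1 ≤ n → 0 < g n)
    (h : Tendsto (fun n => cellRate n (μ n) (g n)) atTop (𝓝 b)) :
    Tendsto (fun n => cellMean n (μ n ^ n) (g n)) atTop atTop := by
  obtain ⟨q, hq1, hqb⟩ := exists_between hb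
  have hlim : Tendsto (fun n : ℕ => Real.exp (-1) * (q ^ 2) ^ n) atTop atTop :=
    (tendsto_pow_atTop_atTop_of_one_lt (by nlinarith : 1 < q ^ 2)).const_mul_atTop (Real.exp_pos _)
  refine tendsto_atTop_mono' _ ?_ (Real.tendsto_sqrt_atTop.comp hlim)
  filter_upwards [eventually_ge_atTop 1, h.eventually_const_lt hqb] with n hn hlt
  have h1 := hμ n hn
  have h2 := hg n hn
  have hn0 : (0 : ℝ) < n := by exact_mod_cast hn
  have hpos : 0 ≤ cellMean n (μ n ^ n) (g n) := by
    have := meanAbsInner_pos hn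
    have := Real.Gamma_pos_of_pos (show (0 : ℝ) < (n : ℝ) / 2 + 1 by positivity)
    unfold cellMean
    positivity
  have hle : Real.exp (-1) * (q ^ 2) ^ n ≤
      Real.exp (-1) * (cellRate n (μ n) (g n) ^ 2) ^ n := by
    gcongr
  exact Real.sqrt_le_iff.2 ⟨hpos, hle.trans (le_cellMean_sq hn h2)⟩

/-- The factor `n` in `cellRate` lifts `n ^ (α - 1)` to `n ^ α`, the growth of `γ`; this is why the
intensity of `N` has its exponent. -/
theorem tendsto_cellRate {lam α ρ t : ℝ} (hρ : 0 < ρ) (ht : 0 < t) {γ : ℕ → ℝ}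
    (hγ : γ ~[atTop] fun n : ℕ => ρ * (n : ℝ) ^ α) :
    Tendsto (fun n : ℕ => cellRate n ((n : ℝ) ^ (α - 1) * Real.exp lam) (t * γ n)) atTop
      (𝓝 (Real.exp lam * Real.pi / √(Real.exp 1) / (t * ρ))) := by
  have hne : ∀ᶠ n : ℕ in atTop, ρ * (n : ℝ) ^ α ≠ 0 := by
    filter_upwards [eventually_ge_atTop 1] with n hn
    have : (0 : ℝ) < n := by exact_mod_cast hn
    positivity
  have h1 := (isEquivalent_iff_tendsto_one hne).1 hγ
  have h2 := (h1.inv₀ one_ne_zero).const_mul (Real.exp lam * Real.pi / √(Real.exp 1) / (t * ρ))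
  rw [inv_one, mul_one] at h2
  refine h2.congr' ?_
  filter_upwards [eventually_ge_atTop 1] with n hn
  have hn0 : (0 : ℝ) < n := by exact_mod_cast hn
  have hs : 0 < √(Real.exp 1) := Real.sqrt_pos.2 (Real.exp_pos 1)
  rw [Pi.div_apply, cellRate, Real.rpow_sub_one hn0.ne', inv_div]
  field_simp

end

theorem propositionp
    {Ω : ℕ → Type*} [∀ n, MeasurableSpace (Ω n)]
    (P : ∀ n, Measure (Ω n)) [∀ n, IsProbabilityMeasure (P n)]
    (θ : ∀ n, Eucl n → Ω n → Ω n)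
    (N : ∀ n, Ω n → Measure (Eucl n)) (X : ∀ n, Ω n → Measure (Hyperplane n))
    (lam α ρ : ℝ) (hρ : 0 < ρ)
    (lamSeq γ : ℕ → ℝ)
    (hlam : ∀ n, 1 ≤ n → lamSeq n = (n : ℝ) ^ ((n : ℝ) * (α - 1)) * Real.exp (n * lam))
    (hγ_pos : ∀ n, 1 ≤ n → 0 < γ n)
    (hγ : γ ~[atTop] fun n : ℕ => ρ * (n : ℝ) ^ α)
    (hmodel : ∀ n, 1 ≤ n → IsPoissonCompression (P n) (θ n) (N n) (X n) (lamSeq n) (γ n))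
    (B : ∀ n, Set (Eucl n))
    (hB : ∀ n, 1 ≤ n → MeasurableSet (B n) ∧ Bornology.IsBounded (B n) ∧ volume (B n) = 1) :
    (Real.exp lam * Real.pi / √(Real.exp 1) < ρ →
      Tendsto (fun n => reducedPalmMean (P n) (θ n) (N n) (lamSeq n) (B n)
        fun ω => zeroCell (X n ω)) atTop (𝓝 0)) ∧
    (ρ < Real.exp lam * Real.pi / √(Real.exp 1) →
      Tendsto (fun n => reducedPalmMean (P n) (θ n) (N n) (lamSeq n) (B n)
        fun ω => zeroCell (X n ω)) atTop (𝓝 ⊤)) ∧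
    (Real.exp lam * Real.pi / √(Real.exp 1) < ρ →
      Tendsto (fun n => palm (P n) (θ n) (N n) (lamSeq n) (B n)
        {ω | N n ω (zeroCell (X n ω)) = 1}) atTop (𝓝 1)) := by
  set r := Real.exp lam * Real.pi / √(Real.exp 1) with hr
  have hr0 : 0 < r := by positivity
  let μ : ℕ → ℝ := fun n => (n : ℝ) ^ (α - 1) * Real.exp lam
  have hμ : ∀ n, 1 ≤ n → 0 < μ n := fun n hn => by
    have : (0 : ℝ) < n := by exact_mod_cast hn
    positivity
  have hμn : ∀ n, 1 ≤ n → lamSeq n = μ n ^ n := fun n hn => by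
    have : (0 : ℝ) < n := by exact_mod_cast hn
    rw [hlam n hn, mul_pow, ← Real.exp_nat_mul, ← Real.rpow_mul_natCast this.le, mul_comm (α - 1)]
  have hlam_pos : ∀ n, 1 ≤ n → 0 < lamSeq n := fun n hn => by
    rw [hμn n hn]
    exact pow_pos (hμ n hn) n
  have hsmall : r < ρ → ∃ t, 0 < t ∧ t < 1 ∧
      Tendsto (fun n => ENNReal.ofReal (cellMean n (lamSeq n) (t * γ n))) atTop (𝓝 0) := by
    intro hlt
    -- Shrinking by `t` replaces `ρ` by `t ρ`; the choice `r / ρ < t < 1` keeps `t ρ` above the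
    -- threshold `r`.
    obtain ⟨t, ht, ht1⟩ := exists_between ((div_lt_one hρ).2 hlt)
    have ht0 : 0 < t := (div_pos hr0 hρ).trans ht
    refine ⟨t, ht0, ht1, ?_⟩
    have hb : r / (t * ρ) < 1 := by
      rw [div_lt_one (mul_pos ht0 hρ)]
      exact (div_lt_iff₀ hρ).1 ht
    have h := tendsto_cellMean_zero hb hμ (fun n hn => mul_pos ht0 (hγ_pos n hn))
      (tendsto_cellRate hρ ht0 hγ)
    rw [← ENNReal.ofReal_zero]
    refine (ENNReal.continuous_ofReal.tendsto 0).comp (h.congr' ?_)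
    filter_upwards [eventually_ge_atTop 1] with n hn
    rw [hμn n hn]
  refine ⟨fun hlt => ?_, fun hlt => ?_, fun hlt => ?_⟩
  · obtain ⟨t, ht0, ht1, ht⟩ := hsmall hlt
    refine tendsto_of_tendsto_of_tendsto_of_le_of_le' tendsto_const_nhds ht
      (.of_forall fun n => zero_le) ?_
    filter_upwards [eventually_ge_atTop 1] with n hn
    exact (hmodel n hn).reducedPalmMean_le hn (hlam_pos n hn) (hγ_pos n hn) (hB n hn).1
      (hB n hn).2.2 ht0 ht1
  -- The lower bound needs no shrinking, so the rate is taken at `t = 1`.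
  · have hb : 1 < r / (1 * ρ) := by
      rwa [one_mul, one_lt_div hρ]
    have h := tendsto_cellMean_atTop hb hμ (fun n hn => mul_pos one_pos (hγ_pos n hn))
      (tendsto_cellRate hρ one_pos hγ)
    refine tendsto_of_tendsto_of_tendsto_of_le_of_le' (ENNReal.tendsto_ofReal_atTop.comp h)
      tendsto_const_nhds ?_ (.of_forall fun n => le_top)
    filter_upwards [eventually_ge_atTop 1] with n hn
    have := (hmodel n hn).le_reducedPalmMean hn (hlam_pos n hn) (hγ_pos n hn) (hB n hn).1
      (hB n hn).2.2
    rw [Function.comp_apply, one_mul, ← hμn n hn]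
    exact this
  · obtain ⟨t, ht0, ht1, ht⟩ := hsmall hlt
    have h1 := ENNReal.Tendsto.sub (tendsto_const_nhds (x := (1 : ENNReal))) ht
      (Or.inl ENNReal.one_ne_top)
    rw [tsub_zero] at h1
    refine tendsto_of_tendsto_of_tendsto_of_le_of_le' h1 tendsto_const_nhds ?_ ?_
    · filter_upwards [eventually_ge_atTop 1] with n hn
      exact (hmodel n hn).le_palm_data_zeroCell_eq_one hn (hlam_pos n hn) (hγ_pos n hn) (hB n hn).1
        (hB n hn).2.2 ht0 ht1
    · filter_upwards [eventually_ge_atTop 1] with n hn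
      rw [← (hmodel n hn).palm_univ (hlam_pos n hn) (hB n hn).1 (hB n hn).2.2]
      exact measure_mono (Set.subset_univ _)
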